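/- Let $d\in\{2,3\}$ and $m\in\{d,d-1\}$, let $\Omega\subset\mathbb R^d$ and $\mathcal B\subset\mathbb R^m$ be bounded open sets, $T>0$, and let $\rho_f,\rho_s,\nu,t_s>0$. Put $\delta\rho=\rho_s-\rho_f$ if $m=d$ and $\delta\rho=(\rho_s-\rho_f)t_s$ if $m=d-1$. Let $W\ge 0$ be a convex $C^1$ function on $\mathbb R^{d\times m}$, $\mathbb P=\partial W/\partial\mathbb F$, and $E(X)=\int_{\mathcal B}W(\mathbb F)\,ds$ with $\mathbb F=\nabla_sX$. Write $(\cdot,\cdot)$ and $\|\cdot\|_0$ for the product and norm of $L^2(\Omega)$, $(\cdot,\cdot)_{\mathcal B}$ and $\|\cdot\|_{0,\mathcal B}$ for those of $L^2(\mathcal B)$, $\nabla_{\rm sym}v=\nabla v+(\nabla v)^{\top}$, $L^2_0(\Omega)$ for the functions in $L^2(\Omega)$ of mean zero, and $$\mathcal N(u,p;v)=\rho_f\Big(\tfrac{d}{dt}(u,v)+\tfrac12\big[(u\cdot\nabla u,v)-(u\cdot\nabla v,u)\big]\Big)+\nu(\nabla_{\rm sym}u,\nabla_{\rm sym}v)-(\operatorname{div}v,p).$$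 For $v\in H^1_0(\Omega)^d$, $v(X)\in L^2(\mathcal B)^d$ denotes the composition with $X$, understood (as a trace) by continuous extension of $\varphi\mapsto\varphi\circ X$ from $\varphi\in C_c^\infty(\Omega)^d$: $v(X)=Y$ means that some $\varphi_n\in C_c^\infty(\Omega)^d$ satisfy $\varphi_n\to v$ in $H^1(\Omega)^d$ and $\varphi_n\circ X\to Y$ in $L^2(\mathcal B)^d$. Solutions are understood in the following class: $u\in L^2(0,T;H^1_0(\Omega)^d)$ with $\partial_tu\in L^2(0,T;H^{-1}(\Omega)^d)$; $p(t)\in L^2_0(\Omega)$ for a.e. $t$; $X\in H^1(0,T;H^1(\mathcal B)^d)$ with values in $\Omega$, $\partial_t^2X\in L^2(0,T;L^2(\mathcal B)^d)$ and $\mathbb P(\mathbb F)\in L^2(0,T;L^2(\mathcal B)^{d\times m})$ (for $u$, $X$, $\mathbb F$, $\partial_tX$ the representatives continuous in time are taken, for $u$ weakly). Moreover $u(0)=u_0\in H^1_0(\Omega)^d$, $X(0)=X_0$, and $(\operatorname{div}u(t),q)=0$ for all $q\in L^2_0(\Omega)$ and a.e. $t$. **(FE-IBM)** $(u,p,X)$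 solves the continuous FE-IBM problem if, in addition, $X_0:\mathcal B\to\Omega$ and for a.e. $t\in\,]0,T[$: $X(t)\in W^{1,\infty}(\mathcal B)^d$, $\frac{\partial X}{\partial t}(t)=u(t)(X(t))$, and $$\mathcal N(u,p;v)=-\delta\rho\int_{\mathcal B}\frac{\partial^2X}{\partial t^2}\cdot v(X(s,t))\,ds-\int_{\mathcal B}\mathbb P(\mathbb F(s,t)):\nabla_sv(X(s,t))\,ds$$ for all $v\in H^1_0(\Omega)^d$ for which $v(X(t))\in H^1(\mathcal B)^d$. **(DLM)** Let $\Lambda$ be a real vector space, $\mathcal H_1,\mathcal H_2\subset L^2(\mathcal B)^d$ subspaces with $H^1(\mathcal B)^d\subset\mathcal H_2$, and $c_1:\Lambda\times\mathcal H_1\to\mathbb R$, $c_2:\Lambda\times\mathcal H_2\to\mathbb R$ bilinear forms such that, for a.e. $t$ and $\overline X=X(t)$, if $v\in H^1_0(\Omega)^d$ with $v(\overline X)\in\mathcal H_1$ and $Y\in\mathcal H_2$ satisfy $c_1(\mu,v(\overline X))-c_2(\mu,Y)=0$ for all $\mu\in\Lambda$, then $v(\overline X)=Y$. Then $(u,p,X,\lambda)$,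 $\lambda(t)\in\Lambda$, solves the continuous DLM problem if, in addition to the above, $X_0\in W^{1,\infty}(\mathcal B)^d$ and for a.e. $t\in\,]0,T[$ $$\mathcal N(u,p;v)+c_1(\lambda(t),v(X(t)))=0\quad\forall v\in H^1_0(\Omega)^d\text{ with }v(X(t))\in\mathcal H_1,$$ $$\delta\rho\Big(\frac{\partial^2X}{\partial t^2},Y\Big)_{\mathcal B}+(\mathbb P(\mathbb F),\nabla_sY)_{\mathcal B}-c_2(\lambda(t),Y)=0\quad\forall Y\in H^1(\mathcal B)^d,$$ $$u(t)(X(t))\in\mathcal H_1,\qquad c_1(\mu,u(t)(X(t)))-c_2\Big(\mu,\frac{\partial X}{\partial t}(t)\Big)=0\quad\forall\mu\in\Lambda.$$ **Proposition.** For every solution of the continuous FE-IBM problem and for every solution of the continuous DLM problem, $\|u(t)\|_0^2$, $\|\partial_tX(t)\|_{0,\mathcal B}^2$ and $E(X(t))$ are finite for every $t\in[0,T[$ and absolutely continuous on $[0,b]$ for every $b<T$, and for a.e. $t\in\,]0,T[$ they are differentiable at $t$ with $$\frac{\rho_f}{2}\frac{d}{dt}\|u(t)\|_0^2+\nu\|\nabla_{\rm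 sym}u(t)\|_0^2+\frac{\delta\rho}{2}\frac{d}{dt}\Big\|\frac{\partial X}{\partial t}\Big\|_{0,\mathcal B}^2+\frac{d}{dt}E(X(t))=0.$$ -/

import Mathlib

open MeasureTheory Set Filter Topology
open scoped ContDiff InnerProductSpace

noncomputable section

namespace FSI

/-- Vectors of `ℝⁿ` with the Euclidean norm. -/
abbrev Vec (n : ℕ) := EuclideanSpace ℝ (Fin n)

/-- Tensors `A = (A_{ij})`, `i < d`, `j < m`; the inner product is the Frobenius product `A : B`.
The gradient of `v : ℝᵐ → ℝᵈ` has the entries `A_{ij} = ∂v_i/∂x_j`. -/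
abbrev Tensor (d m : ℕ) := EuclideanSpace ℝ (Fin d × Fin m)

/-- The classical gradient `∇φ` of a differentiable field. -/
def grad {d m : ℕ} (φ : Vec m → Vec d) (x : Vec m) : Tensor d m :=
  WithLp.toLp 2 fun ij => (fderiv ℝ φ x (EuclideanSpace.single ij.2 1)) ij.1

/-- The symmetric gradient `∇v + (∇v)ᵀ`, as a function of the gradient. -/
def symGrad {d : ℕ} (A : Tensor d d) : Tensor d d :=
  WithLp.toLp 2 fun ij => A (ij.1, ij.2) + A (ij.2, ij.1)

/-- The divergence as a function of the gradient. -/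
def divG {d : ℕ} (A : Tensor d d) : ℝ := ∑ i, A (i, i)

/-- The convective derivative `w · ∇v`, as a function of `w` and of the gradient `A = ∇v`. -/
def convect {d : ℕ} (w : Vec d) (A : Tensor d d) : Vec d :=
  WithLp.toLp 2 fun i => ∑ j, w j * A (i, j)

/-- `φ ∈ C_c^∞(U)`. -/
structure IsTest {n : ℕ} {E : Type*} [NormedAddCommGroup E] [NormedSpace ℝ E]
    (U : Set (Vec n)) (φ : Vec n → E) : Prop where
  smooth : ContDiff ℝ ∞ φ
  compact : HasCompactSupport φ
  support : tsupport φ ⊆ U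

/-- `G` is the weak gradient of `Y` in the open set `U`. -/
def HasWeakGrad {d m : ℕ} (U : Set (Vec m)) (Y : Vec m → Vec d) (G : Vec m → Tensor d m) : Prop :=
  ∀ φ : Vec m → ℝ, IsTest U φ → ∀ (i : Fin d) (j : Fin m),
    ∫ s in U, Y s i * fderiv ℝ φ s (EuclideanSpace.single j 1) = - ∫ s in U, G s (i, j) * φ s

/-- `Y ∈ H¹(U)ᵈ` with weak gradient `G`. -/
structure IsH1 {d m : ℕ} (U : Set (Vec m)) (Y : Vec m → Vec d) (G : Vec m → Tensor d m) :
    Prop where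
  memLp : MemLp Y 2 (volume.restrict U)
  memLp_grad : MemLp G 2 (volume.restrict U)
  weakGrad : HasWeakGrad U Y G

/-- `Y ∈ W^{1,∞}(U)ᵈ` with weak gradient `G`. -/
structure IsW1Inf {d m : ℕ} (U : Set (Vec m)) (Y : Vec m → Vec d) (G : Vec m → Tensor d m) :
    Prop where
  memLp : MemLp Y ⊤ (volume.restrict U)
  memLp_grad : MemLp G ⊤ (volume.restrict U)
  weakGrad : HasWeakGrad U Y G

/-- The test fields `φ n` converge in `H¹(Ω)ᵈ` to the field `v` with gradient `Dv`. -/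
structure TestsTendsto {d : ℕ} (Ω : Set (Vec d)) (φ : ℕ → Vec d → Vec d) (v : Vec d → Vec d)
    (Dv : Vec d → Tensor d d) : Prop where
  test : ∀ n, IsTest Ω (φ n)
  tendsto : Tendsto (fun n => eLpNorm (fun x => φ n x - v x) 2 (volume.restrict Ω)) atTop (𝓝 0)
  tendsto_grad :
    Tendsto (fun n => eLpNorm (fun x => grad (φ n) x - Dv x) 2 (volume.restrict Ω)) atTop (𝓝 0)

/-- `v ∈ H¹₀(Ω)ᵈ` with gradient `Dv`: the closure of `C_c^∞(Ω)ᵈ` in `H¹(Ω)ᵈ`. -/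
structure IsH10 {d : ℕ} (Ω : Set (Vec d)) (v : Vec d → Vec d) (Dv : Vec d → Tensor d d) :
    Prop where
  memLp : MemLp v 2 (volume.restrict Ω)
  memLp_grad : MemLp Dv 2 (volume.restrict Ω)
  approx : ∃ φ : ℕ → Vec d → Vec d, TestsTendsto Ω φ v Dv

/-- `q ∈ L²₀(Ω)`: square integrable with mean value zero. -/
structure IsL20 {d : ℕ} (Ω : Set (Vec d)) (q : Vec d → ℝ) : Prop where
  memLp : MemLp q 2 (volume.restrict Ω)
  mean : ∫ x in Ω, q x = 0

/-- `v(X) = Y` in `L²(B)ᵈ`, for `v ∈ H¹₀(Ω)ᵈ` with gradient `Dv` and a map `X` of `B`. As `v` is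
only defined up to null sets and `X(B)` may be one, `v(X)` is the value at `v` of the
extension by continuity of `φ ↦ φ ∘ X`, `φ ∈ C_c^∞(Ω)ᵈ`: the plain composition
when `X` is a bi-Lipschitz map between sets of the same dimension, the trace on the
hypersurface parametrized by `X` in codimension one. -/
def IsComp {d m : ℕ} (Ω : Set (Vec d)) (B : Set (Vec m)) (v : Vec d → Vec d)
    (Dv : Vec d → Tensor d d) (X : Vec m → Vec d) (Y : Vec m → Vec d) : Prop :=
  MemLp Y 2 (volume.restrict B) ∧
    ∃ φ : ℕ → Vec d → Vec d, TestsTendsto Ω φ v Dv ∧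
      Tendsto (fun n => eLpNorm (fun s => φ n (X s) - Y s) 2 (volume.restrict B)) atTop (𝓝 0)

/-- Lebesgue measure on `]0,T[ × U`. Square integrability for it is membership in
`L²(0,T;L²(U))`. -/
def slab {n : ℕ} (T : ℝ) (U : Set (Vec n)) : Measure (ℝ × Vec n) :=
  (volume.restrict (Ioo 0 T)).prod (volume.restrict U)

/-- `f ∈ H¹(0,T;L²(U))` with time derivative `f'`; `f` is the representative that is
continuous in time with values in `L²(U)`. -/
structure HasTimeDeriv {n : ℕ} {E : Type*} [NormedAddCommGroup E] [NormedSpace ℝ E]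
    (T : ℝ) (U : Set (Vec n)) (f f' : ℝ → Vec n → E) : Prop where
  initial : MemLp (f 0) 2 (volume.restrict U)
  memLp : MemLp (Function.uncurry f) 2 (slab T U)
  memLp_deriv : MemLp (Function.uncurry f') 2 (slab T U)
  eq_integral : ∀ t ∈ Ico 0 T, ∀ᵐ s ∂(volume.restrict U), f t s = f 0 s + ∫ r in 0..t, f' r s

/-- `∂u/∂t ∈ L²(0,T;H⁻¹(Ω)ᵈ)`; `u` is the representative for which every `(u(t), v)` is
continuous in time. An element of `H⁻¹` is a functional `v ↦ (g, v) + (G, ∇v)` with `g`, `G`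
square integrable. -/
def HasTimeDerivHm1 {d : ℕ} (T : ℝ) (Ω : Set (Vec d)) (u : ℝ → Vec d → Vec d) : Prop :=
  ∃ (g : ℝ → Vec d → Vec d) (G : ℝ → Vec d → Tensor d d),
    MemLp (Function.uncurry g) 2 (slab T Ω) ∧ MemLp (Function.uncurry G) 2 (slab T Ω) ∧
    ∀ v Dv, IsH10 Ω v Dv → ∀ t ∈ Ico 0 T,
      ∫ x in Ω, ⟪u t x, v x⟫_ℝ = (∫ x in Ω, ⟪u 0 x, v x⟫_ℝ) +
        ∫ r in 0..t, ((∫ x in Ω, ⟪g r x, v x⟫_ℝ) + ∫ x in Ω, ⟪G r x, Dv x⟫_ℝ)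

/-- The scaled density difference, for a solid of dimension `m` in `ℝᵈ`. -/
def deltaRho (d m : ℕ) (ρf ρs ts : ℝ) : ℝ := if m = d then ρs - ρf else (ρs - ρf) * ts

/-- The Piola-Kirchhoff stress `P(F) = ∂W/∂F`. -/
def stress {d m : ℕ} (W : Tensor d m → ℝ) (F : Tensor d m) : Tensor d m := gradient W F

/-- The unknown fields: velocity and its gradient, pressure, position of the solid, deformation
gradient `F = ∇_s X`, `∂X/∂t`, `∇_s ∂X/∂t` and `∂²X/∂t²`. -/
structure Fields (d m : ℕ) where
  u : ℝ → Vec d → Vec d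
  gradU : ℝ → Vec d → Tensor d d
  p : ℝ → Vec d → ℝ
  X : ℝ → Vec m → Vec d
  F : ℝ → Vec m → Tensor d m
  Xt : ℝ → Vec m → Vec d
  gradXt : ℝ → Vec m → Tensor d m
  Xtt : ℝ → Vec m → Vec d

/-- What both formulations require of the fields apart from the equations: the spaces they
belong to, the meaning of the gradients and of the time derivatives, and incompressibility. -/
structure IsAdmissible {d m : ℕ} (T : ℝ) (Ω : Set (Vec d)) (B : Set (Vec m))
    (W : Tensor d m → ℝ) (f : Fields d m) : Prop where
  u_memLp : ∀ t ∈ Ico 0 T, MemLp (f.u t) 2 (volume.restrict Ω)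
  u_slab : MemLp (Function.uncurry f.u) 2 (slab T Ω)
  gradU_slab : MemLp (Function.uncurry f.gradU) 2 (slab T Ω)
  u_H10 : ∀ᵐ t ∂(volume.restrict (Ioo 0 T)), IsH10 Ω (f.u t) (f.gradU t)
  u_time : HasTimeDerivHm1 T Ω f.u
  p_L20 : ∀ᵐ t ∂(volume.restrict (Ioo 0 T)), IsL20 Ω (f.p t)
  X_time : HasTimeDeriv T B f.X f.Xt
  F_time : HasTimeDeriv T B f.F f.gradXt
  Xt_time : HasTimeDeriv T B f.Xt f.Xtt
  X_H1 : ∀ t ∈ Ico 0 T, IsH1 B (f.X t) (f.F t)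
  Xt_H1 : ∀ᵐ t ∂(volume.restrict (Ioo 0 T)), IsH1 B (f.Xt t) (f.gradXt t)
  X_range : ∀ᵐ t ∂(volume.restrict (Ioo 0 T)), ∀ᵐ s ∂(volume.restrict B), f.X t s ∈ Ω
  stress_slab : MemLp (Function.uncurry fun t s => stress W (f.F t s)) 2 (slab T B)
  div_free : ∀ᵐ t ∂(volume.restrict (Ioo 0 T)), ∀ q, IsL20 Ω q →
    ∫ x in Ω, divG (f.gradU t x) * q x = 0

/-- The fluid part of the momentum equation at time `t`, tested with `v`; `D` stands for
`d/dt (u(t), v)`: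
`ρf (D + ((u·∇u, v) - (u·∇v, u)) / 2) + ν (∇_sym u, ∇_sym v) - (div v, p)`. -/
def fluidForm {d m : ℕ} (Ω : Set (Vec d)) (ρf ν : ℝ) (f : Fields d m) (t : ℝ)
    (v : Vec d → Vec d) (Dv : Vec d → Tensor d d) (D : ℝ) : ℝ :=
  ρf * (D + ((∫ x in Ω, ⟪convect (f.u t x) (f.gradU t x), v x⟫_ℝ)
      - ∫ x in Ω, ⟪convect (f.u t x) (Dv x), f.u t x⟫_ℝ) / 2)
    + ν * (∫ x in Ω, ⟪symGrad (f.gradU t x), symGrad (Dv x)⟫_ℝ)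
    - ∫ x in Ω, divG (Dv x) * f.p t x

/-- The fields solve the variational formulation of the immersed boundary method. The momentum
equation is tested with all `v ∈ H¹₀(Ω)ᵈ` for which `∇_s v(X)` is a square integrable function. -/
structure IsIBMSolution {d m : ℕ} (T : ℝ) (Ω : Set (Vec d)) (B : Set (Vec m)) (ρf ν δρ : ℝ)
    (W : Tensor d m → ℝ) (u₀ : Vec d → Vec d) (X₀ : Vec m → Vec d) (f : Fields d m) : Prop where
  admissible : IsAdmissible T Ω B W f
  X_W1Inf : ∀ᵐ t ∂(volume.restrict (Ioo 0 T)), IsW1Inf B (f.X t) (f.F t)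
  momentum : ∀ᵐ t ∂(volume.restrict (Ioo 0 T)), ∀ v Dv Y DY,
    IsH10 Ω v Dv → IsH1 B Y DY → IsComp Ω B v Dv (f.X t) Y →
      ∃ D, HasDerivAt (fun τ => ∫ x in Ω, ⟪f.u τ x, v x⟫_ℝ) D t ∧
        fluidForm Ω ρf ν f t v Dv D =
          - δρ * (∫ s in B, ⟪f.Xtt t s, Y s⟫_ℝ) - ∫ s in B, ⟪stress W (f.F t s), DY s⟫_ℝ
  motion : ∀ᵐ t ∂(volume.restrict (Ioo 0 T)),
    IsComp Ω B (f.u t) (f.gradU t) (f.X t) (f.Xt t)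
  u₀_H10 : ∃ Du₀, IsH10 Ω u₀ Du₀
  X₀_range : MapsTo X₀ B Ω
  initial_u : f.u 0 =ᵐ[volume.restrict Ω] u₀
  initial_X : f.X 0 =ᵐ[volume.restrict B] X₀

/-- The fields and the multiplier `mult` solve the formulation with a distributed Lagrange
multiplier. The bilinear forms `c₁` on `Λ × H₁` and `c₂` on `Λ × H₂` couple the solid and the fluid
velocity; `H₁` and `H₂` are spaces of square integrable functions on `B`. -/
structure IsDLMSolution {d m : ℕ} (T : ℝ) (Ω : Set (Vec d)) (B : Set (Vec m)) (ρf ν δρ : ℝ)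
    (W : Tensor d m → ℝ) (u₀ : Vec d → Vec d) (X₀ : Vec m → Vec d) (f : Fields d m)
    {Λ : Type*} [AddCommGroup Λ] [Module ℝ Λ]
    (H₁ H₂ : Submodule ℝ (Lp (Vec d) 2 (volume.restrict B)))
    (c₁ : Λ →ₗ[ℝ] H₁ →ₗ[ℝ] ℝ) (c₂ : Λ →ₗ[ℝ] H₂ →ₗ[ℝ] ℝ) (mult : ℝ → Λ) : Prop where
  le_H₂ : ∀ y : Lp (Vec d) 2 (volume.restrict B), (∃ DY, IsH1 B y DY) → y ∈ H₂
  recover : ∀ᵐ t ∂(volume.restrict (Ioo 0 T)), ∀ v Dv (z : H₁) (y : H₂),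
    IsH10 Ω v Dv → IsComp Ω B v Dv (f.X t) z.1 → (∀ μ, c₁ μ z - c₂ μ y = 0) → z.1 = y.1
  admissible : IsAdmissible T Ω B W f
  fluid : ∀ᵐ t ∂(volume.restrict (Ioo 0 T)), ∀ v Dv (z : H₁),
    IsH10 Ω v Dv → IsComp Ω B v Dv (f.X t) z.1 →
      ∃ D, HasDerivAt (fun τ => ∫ x in Ω, ⟪f.u τ x, v x⟫_ℝ) D t ∧
        fluidForm Ω ρf ν f t v Dv D + c₁ (mult t) z = 0
  solid : ∀ᵐ t ∂(volume.restrict (Ioo 0 T)), ∀ (y : H₂) DY, IsH1 B y.1 DY →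
    δρ * (∫ s in B, ⟪f.Xtt t s, y.1 s⟫_ℝ) + (∫ s in B, ⟪stress W (f.F t s), DY s⟫_ℝ)
      - c₂ (mult t) y = 0
  motion : ∀ᵐ t ∂(volume.restrict (Ioo 0 T)), ∃ (z : H₁) (y : H₂),
    IsComp Ω B (f.u t) (f.gradU t) (f.X t) z.1 ∧ y.1 =ᵐ[volume.restrict B] f.Xt t ∧
      ∀ μ, c₁ μ z - c₂ μ y = 0
  u₀_H10 : ∃ Du₀, IsH10 Ω u₀ Du₀
  X₀_W1Inf : ∃ DX₀, IsW1Inf B X₀ DX₀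
  initial_u : f.u 0 =ᵐ[volume.restrict Ω] u₀
  initial_X : f.X 0 =ᵐ[volume.restrict B] X₀

/-- The squared norm `‖g‖²` of `L²(U)`. -/
def l2Sq {n : ℕ} {E : Type*} [NormedAddCommGroup E] (U : Set (Vec n)) (g : Vec n → E) : ℝ :=
  ∫ x in U, ‖g x‖ ^ 2

/-- The elastic energy `∫_B W(F)`. -/
def elasticEnergy {d m : ℕ} (B : Set (Vec m)) (W : Tensor d m → ℝ) (F : Vec m → Tensor d m) : ℝ :=
  ∫ s in B, W (F s)

/-- The energy identity on `]0,T[`. All energies are finite at all times, they are absolutely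
continuous on `[0,b]` for every `b < T`, and for almost every `t` they are differentiable and
`ρf/2 d/dt ‖u‖² + ν ‖∇_sym u‖² + δρ/2 d/dt ‖∂X/∂t‖² + d/dt E(X) = 0`. -/
def EnergyIdentity {d m : ℕ} (T : ℝ) (Ω : Set (Vec d)) (B : Set (Vec m)) (ρf ν δρ : ℝ)
    (W : Tensor d m → ℝ) (f : Fields d m) : Prop :=
  (∀ t ∈ Ico 0 T, MemLp (f.u t) 2 (volume.restrict Ω) ∧ MemLp (f.Xt t) 2 (volume.restrict B) ∧
    IntegrableOn (fun s => W (f.F t s)) B) ∧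
  (∀ b ∈ Ioo 0 T,
    AbsolutelyContinuousOnInterval (fun t => l2Sq Ω (f.u t)) 0 b ∧
    AbsolutelyContinuousOnInterval (fun t => l2Sq B (f.Xt t)) 0 b ∧
    AbsolutelyContinuousOnInterval (fun t => elasticEnergy B W (f.F t)) 0 b) ∧
  ∀ᵐ t ∂(volume.restrict (Ioo 0 T)),
    MemLp (fun x => symGrad (f.gradU t x)) 2 (volume.restrict Ω) ∧
    ∃ k s e : ℝ, HasDerivAt (fun τ => l2Sq Ω (f.u τ)) k t ∧
      HasDerivAt (fun τ => l2Sq B (f.Xt τ)) s t ∧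
      HasDerivAt (fun τ => elasticEnergy B W (f.F τ)) e t ∧
      ρf / 2 * k + ν * l2Sq Ω (fun x => symGrad (f.gradU t x)) + δρ / 2 * s + e = 0

end FSI

end

/-!
The energy identity is the momentum equation tested with the velocity `u(t)` itself. Its value on
the solid is `∂X/∂t`, so the right-hand side of the immersed boundary formulation becomes `-δρ
(∂²X/∂t², ∂X/∂t) - (P(F), ∇_s ∂X/∂t)`; with a Lagrange multiplier the same expression appears when
the fluid equation for `u(t)` and the solid equation for `∂X/∂t` are added, since the coupling
condition makes the multiplier terms cancel. The convective terms cancel and the pressure drops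
out (`fluidForm_self`). What remains is to recognize three time derivatives, and to show that the
energies are absolutely continuous.

For `‖∂X/∂t‖²` and the elastic energy this is one statement, `HasTimeDeriv.energy`: if `f` belongs
to `H¹(0,T;L²)` and `W ≥ 0` is convex and `C¹` with `∇W(f)` square integrable, then `∫ W(f)` is
finite at all times with derivative `(∇W(f), f')`. It is the chain rule for absolutely continuous
curves at fixed `s`, integrated over `s` by Fubini; convexity makes the energy finite at one time.

The kinetic energy of the fluid is harder, because `∂u/∂t` is only a functional on `H¹₀`
(`kineticEnergy`). The equality `‖u(t)‖² = ‖u(0)‖² + 2 ∫₀ᵗ ⟨∂u/∂t, u⟩` is proved in an abstract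
Hilbert space setting (`norm_sq_eq_of_weak_deriv`). Extend `u` to negative times by its initial
value, which lies in `H¹₀`, and take Steklov averages `u_h`. These are absolutely continuous in
`L²`, with a derivative that pairs with elements of `H¹₀` as the average of `∂u/∂t` does, so they
satisfy the equality, and so do their differences, which start from zero. As the averages of `u`
and of `∂u/∂t` converge in `L²` in time, `u_h(t)` is a Cauchy sequence for every `t`; its limit is
`u(t)` because `u` is weakly continuous and `H¹₀` is dense in `L²`.
-/

open MeasureTheory Set Filter Topology
open scoped ContDiff InnerProductSpace

noncomputable section

namespace FSI

/-! ### Absolutely continuous functions and the chain rule -/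

theorem absolutelyContinuous_of_eq_integral {T a : ℝ} {φ e : ℝ → ℝ} (ha : a ∈ Ico 0 T)
    (he : IntegrableOn e (Ioo 0 T))
    (hφ : ∀ t ∈ Ico 0 T, φ t = φ a + ∫ r in a..t, e r) :
    (∀ b ∈ Ioo 0 T, AbsolutelyContinuousOnInterval φ 0 b) ∧
      ∀ᵐ t ∂(volume.restrict (Ioo 0 T)), HasDerivAt φ (e t) t := by
  have hT : 0 ≤ T := ha.1.trans ha.2.le
  have hi : IntervalIntegrable e volume 0 T := by
    rwa [intervalIntegrable_iff_integrableOn_Ioo_of_le hT]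
  have haT : a ∈ uIcc 0 T := by rw [uIcc_of_le hT]; exact ⟨ha.1, ha.2.le⟩
  constructor
  · intro b hb
    have h1 := (hi.absolutelyContinuousOnInterval_intervalIntegral haT).mono
      (c := 0) (d := b)
      (by rw [uIcc_of_le hT, uIcc_of_le hb.1.le]; exact Icc_subset_Icc_right hb.2.le)
    rw [absolutelyContinuousOnInterval_iff] at *
    intro ε hε
    obtain ⟨δ, hδ, H⟩ := h1 ε hε
    refine ⟨δ, hδ, fun E hE hs => lt_of_eq_of_lt (Finset.sum_congr rfl fun i hi => ?_) (H E hE hs)⟩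
    have hm := hE.1 i hi
    rw [uIcc_of_le hb.1.le] at hm
    rw [hφ _ ⟨hm.1.1, hm.1.2.trans_lt hb.2⟩, hφ _ ⟨hm.2.1, hm.2.2.trans_lt hb.2⟩]
    simp
  · rw [ae_restrict_iff' measurableSet_Ioo]
    filter_upwards [hi.ae_hasDerivAt_integral] with t ht htm
    have := ((ht (by rw [uIcc_of_le hT]; exact Ioo_subset_Icc_self htm) a haT).const_add (φ a))
    refine this.congr_of_eventuallyEq ?_
    filter_upwards [Ioo_mem_nhds htm.1 htm.2] with τ hτ
    exact hφ τ (Ioo_subset_Ico_self hτ)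

/-- The chain rule for a `C¹` function along an absolutely continuous curve, in integrated form. -/
theorem sub_eq_integral_fderiv_comp {E : Type*} [NormedAddCommGroup E] [NormedSpace ℝ E]
    [CompleteSpace E] {W : E → ℝ} (hW : ContDiff ℝ 1 W) {z z' : ℝ → E} {a b : ℝ}
    (hz' : IntervalIntegrable z' volume a b)
    (hz : ∀ t ∈ uIcc a b, z t = z a + ∫ r in a..t, z' r) :
    W (z b) - W (z a) = ∫ r in a..b, fderiv ℝ W (z r) (z' r) := by
  have haa : a ∈ uIcc a b := left_mem_uIcc
  have hcont : ContinuousOn z (uIcc a b) := by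
    refine ContinuousOn.congr ?_ hz
    exact continuousOn_const.add
      (intervalIntegral.continuousOn_primitive_interval' hz' haa)
  obtain ⟨K, hK⟩ := (hW.locallyLipschitz.locallyLipschitzOn
    (s := z '' uIcc a b)).exists_lipschitzOnWith_of_compact
      (isCompact_uIcc.image_of_continuousOn hcont)
  have hsub : ∀ x ∈ uIcc a b, IntervalIntegrable z' volume a x := fun x hx =>
    hz'.mono_set (uIcc_subset_uIcc haa hx)
  have hN := hz'.norm.absolutelyContinuousOnInterval_intervalIntegral haa
  have hAC : AbsolutelyContinuousOnInterval (fun t => W (z t)) a b := by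
    rw [absolutelyContinuousOnInterval_iff] at *
    intro ε hε
    obtain ⟨δ, hδ, H⟩ := hN (ε / (K + 1)) (by positivity)
    refine ⟨δ, hδ, fun E hE hs => ?_⟩
    have := H E hE hs
    rw [lt_div_iff₀' (by positivity), Finset.mul_sum] at this
    refine lt_of_le_of_lt (Finset.sum_le_sum fun i hi => ?_) this
    obtain ⟨h1, h2⟩ := hE.1 i hi
    refine (hK.dist_le_mul _ (mem_image_of_mem z h1) _ (mem_image_of_mem z h2)).trans ?_
    rw [hz _ h1, hz _ h2, dist_add_left, dist_eq_norm, dist_eq_norm,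
      intervalIntegral.integral_interval_sub_left (hsub _ h1) (hsub _ h2),
      intervalIntegral.integral_interval_sub_left (hsub _ h1).norm (hsub _ h2).norm]
    have := intervalIntegral.norm_integral_le_abs_integral_norm (f := z') (a := (E.2 i).2)
      (b := (E.2 i).1) (μ := volume)
    rw [Real.norm_eq_abs]
    gcongr
    simp
  rw [← hAC.integral_deriv_eq_sub]
  refine intervalIntegral.integral_congr_ae ?_
  have hne : ∀ c : ℝ, ∀ᵐ x : ℝ, x ≠ c := fun c => by simp [ae_iff, measure_singleton]
  filter_upwards [hz'.ae_hasDerivAt_integral, hne (max a b)] with t ht hmax htm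
  have htm' : t ∈ Ioo (min a b) (max a b) := ⟨htm.1, lt_of_le_of_ne htm.2 hmax⟩
  have htc : t ∈ uIcc a b := uIoc_subset_uIcc htm
  have h1 := (ht htc a haa).const_add (z a)
  have h2 : HasDerivAt z (z' t) t := by
    refine h1.congr_of_eventuallyEq ?_
    filter_upwards [Ioo_mem_nhds htm'.1 htm'.2] with τ hτ
    exact hz τ (Ioo_subset_Icc_self hτ)
  exact (((hW.differentiable (by norm_num)) (z t)).hasFDerivAt.comp_hasDerivAt t h2).deriv

/-! ### Energies of functions in `H¹(0,T;L²(U))` -/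

theorem isFiniteMeasure_restrict_of_isBounded {n : ℕ} {U : Set (Vec n)}
    (hU : Bornology.IsBounded U) : IsFiniteMeasure (volume.restrict U) :=
  isFiniteMeasure_restrict.2 hU.measure_lt_top.ne

theorem integrable_inner_of_memLp_two {α E : Type*} [MeasurableSpace α] {μ : Measure α}
    [NormedAddCommGroup E] [InnerProductSpace ℝ E] {f g : α → E}
    (hf : MemLp f 2 μ) (hg : MemLp g 2 μ) : Integrable (fun x => ⟪f x, g x⟫_ℝ) μ := by
  refine (hf.norm.integrable_mul hg.norm).mono' (hf.1.inner hg.1) (ae_of_all _ fun x => ?_)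
  simpa using abs_real_inner_le_norm (f x) (g x)

/-- A differentiable convex function lies above its tangents. -/
theorem add_fderiv_le_of_convexOn {E : Type*} [NormedAddCommGroup E] [NormedSpace ℝ E] {W : E → ℝ}
    (hW : Differentiable ℝ W) (hconv : ConvexOn ℝ univ W) (x y : E) :
    W x + fderiv ℝ W x (y - x) ≤ W y := by
  have h1 : ConvexOn ℝ univ (fun θ : ℝ => W (AffineMap.lineMap x y θ)) := by
    simpa using! hconv.comp_affineMap (AffineMap.lineMap x y : ℝ →ᵃ[ℝ] E)
  have h2 : HasDerivAt (fun θ : ℝ => W (AffineMap.lineMap x y θ)) (fderiv ℝ W x (y - x)) 0 := by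
    have h3 : HasFDerivAt W (fderiv ℝ W x) (AffineMap.lineMap x y (0 : ℝ)) := by
      simpa using (hW x).hasFDerivAt
    exact h3.comp_hasDerivAt (0 : ℝ) AffineMap.hasDerivAt_lineMap
  have := h1.le_slope_of_hasDerivAt (mem_univ 0) (mem_univ 1) one_pos h2
  simp [slope_def_field] at this
  rw [map_sub]
  linarith

theorem uIoc_subset_Ioo_of_mem_Ico {a b T : ℝ} (ha : a ∈ Ico 0 T) (hb : b ∈ Ico 0 T) :
    uIoc a b ⊆ Ioo 0 T := fun _ hx =>
  ⟨(le_min ha.1 hb.1).trans_lt hx.1, hx.2.trans_lt (max_lt ha.2 hb.2)⟩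

/-- For almost every `s` the section `f · s` coincides almost everywhere with the primitive of
`f' · s`. The definition has this for every `t` and almost every `s`, with an exceptional set that
depends on `t`; exchanging the quantifiers needs joint measurability of the primitive. -/
theorem HasTimeDeriv.ae_ae_eq {n : ℕ} {E : Type*} [NormedAddCommGroup E] [NormedSpace ℝ E]
    {T : ℝ} {U : Set (Vec n)} (hU : Bornology.IsBounded U) {f f' : ℝ → Vec n → E}
    (h : HasTimeDeriv T U f f') :
    ∀ᵐ s ∂(volume.restrict U), IntegrableOn (fun r => f' r s) (Ioo 0 T) ∧
      ∀ᵐ r ∂(volume.restrict (Ioo 0 T)), f r s = f 0 s + ∫ ρ in 0..r, f' ρ s := by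
  have := isFiniteMeasure_restrict_of_isBounded hU
  have hint' : Integrable (Function.uncurry f') (slab T U) := by
    have : IsFiniteMeasure (slab T U) := by unfold slab; infer_instance
    exact h.memLp_deriv.integrable (by norm_num)
  have hsm' := h.memLp_deriv.1
  have hsm := h.memLp.1
  have hsm0 := h.initial.1
  set g' := hsm'.mk _ with hg'
  set g := hsm.mk _ with hg
  set g0 := hsm0.mk _ with hg0
  have mg' : StronglyMeasurable g' := hsm'.stronglyMeasurable_mk
  have mg : StronglyMeasurable g := hsm.stronglyMeasurable_mk
  have mg0 : StronglyMeasurable g0 := hsm0.stronglyMeasurable_mk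
  have eg' : ∀ᵐ p ∂(slab T U), f' p.1 p.2 = g' p := hsm'.ae_eq_mk
  have eg : ∀ᵐ p ∂(slab T U), f p.1 p.2 = g p := hsm.ae_eq_mk
  have eg0 : ∀ᵐ s ∂(volume.restrict U), f 0 s = g0 s := hsm0.ae_eq_mk
  -- the primitive, written with an indicator so that its joint measurability is visible
  let K : ℝ × Vec n → E := fun p =>
    g0 p.2 + ∫ ρ, {q : (ℝ × Vec n) × ℝ | 0 < q.2 ∧ q.2 ≤ q.1.1}.indicator
      (fun q => g' (q.2, q.1.2)) (p, ρ)
  have mK : StronglyMeasurable K := by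
    refine (mg0.comp_measurable measurable_snd).add ?_
    refine StronglyMeasurable.integral_prod_right (f := fun p ρ =>
      {q : (ℝ × Vec n) × ℝ | 0 < q.2 ∧ q.2 ≤ q.1.1}.indicator
      (fun q => g' (q.2, q.1.2)) (p, ρ)) ?_
    refine StronglyMeasurable.indicator ?_ ?_
    · exact mg'.comp_measurable (by fun_prop)
    · exact (measurableSet_lt measurable_const measurable_snd).inter
        (measurableSet_le measurable_snd (by fun_prop))
  have hK : ∀ r s, 0 ≤ r → K (r, s) = g0 s + ∫ ρ in 0..r, g' (ρ, s) := by
    intro r s hr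
    simp only [K]
    rw [intervalIntegral.integral_of_le hr, ← integral_indicator measurableSet_Ioc]
    rfl
  have eK : ∀ᵐ s ∂(volume.restrict U), ∀ r ∈ Ioo 0 T,
      K (r, s) = f 0 s + ∫ ρ in 0..r, f' ρ s := by
    have e1 : ∀ᵐ q ∂((volume.restrict U).prod (volume.restrict (Ioo 0 T))),
        f' q.2 q.1 = g' (q.2, q.1) :=
      Measure.measurePreserving_swap.quasiMeasurePreserving.ae eg'
    filter_upwards [eg0, Measure.ae_ae_of_ae_prod e1] with s h0 hs r hr
    rw [hK r s hr.1.le, h0]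
    congr 1
    refine intervalIntegral.integral_congr_ae ?_
    rw [ae_restrict_iff' measurableSet_Ioo] at hs
    filter_upwards [hs] with ρ hρ hρm
    rw [uIoc_of_le hr.1.le] at hρm
    exact (hρ ⟨hρm.1, hρm.2.trans_lt hr.2⟩).symm
  have egK : ∀ᵐ p ∂(slab T U), f p.1 p.2 = K p := by
    have e2 : ∀ᵐ p ∂(slab T U), g p = K p := by
      refine (Measure.ae_prod_iff_ae_ae (mg.measurableSet_eq_fun mK)).2 ?_
      filter_upwards [Measure.ae_ae_of_ae_prod eg, ae_restrict_mem measurableSet_Ioo] with r hr hrm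
      filter_upwards [hr, eK, h.eq_integral r (Ioo_subset_Ico_self hrm)] with s h1 h2 h3
      rw [h2 r hrm, ← h3]
      exact h1.symm
    filter_upwards [eg, e2] with p h1 h2 using h1.trans h2
  have egK' : ∀ᵐ q ∂((volume.restrict U).prod (volume.restrict (Ioo 0 T))),
      f q.2 q.1 = K (q.2, q.1) :=
    Measure.measurePreserving_swap.quasiMeasurePreserving.ae egK
  filter_upwards [hint'.prod_left_ae, Measure.ae_ae_of_ae_prod egK', eK] with s h1 h2 h3
  refine ⟨h1, ?_⟩
  filter_upwards [h2, ae_restrict_mem measurableSet_Ioo] with r h4 hr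
  rw [h4, h3 r hr]

/-- For `f ∈ H¹(0,T;L²(U))` and a convex density `W ≥ 0` whose gradient along `f` is square
integrable, the energy `∫_U W(f)` is finite at all times and has the derivative `(∇W(f), f')`.
Convexity bounds `W(f)` by `W(0) + ∇W(f) · f`, so that the energy is finite for almost every `t`;
the chain rule at fixed `s` carries this to every `t`. -/
theorem HasTimeDeriv.energy {n : ℕ} {E : Type*} [NormedAddCommGroup E] [InnerProductSpace ℝ E]
    [CompleteSpace E] {T : ℝ} (hT : 0 < T) {U : Set (Vec n)} (hU : Bornology.IsBounded U)
    {W : E → ℝ} (hW : ContDiff ℝ 1 W) (hconv : ConvexOn ℝ univ W) (hpos : ∀ x, 0 ≤ W x)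
    {f f' : ℝ → Vec n → E} (h : HasTimeDeriv T U f f')
    (hP : MemLp (Function.uncurry fun t s => gradient W (f t s)) 2 (slab T U)) :
    (∀ t ∈ Ico 0 T, AEStronglyMeasurable (f t) (volume.restrict U) ∧
      IntegrableOn (fun s => W (f t s)) U) ∧
    (∀ b ∈ Ioo 0 T, AbsolutelyContinuousOnInterval (fun t => ∫ s in U, W (f t s)) 0 b) ∧
    ∀ᵐ t ∂(volume.restrict (Ioo 0 T)), HasDerivAt (fun t => ∫ s in U, W (f t s))
      (∫ s in U, ⟪gradient W (f t s), f' t s⟫_ℝ) t := by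
  have := isFiniteMeasure_restrict_of_isBounded hU
  have hgrad : ∀ x y, fderiv ℝ W x y = ⟪gradient W x, y⟫_ℝ := fun x y => by
    simp [gradient]
  let H : ℝ → Vec n → ℝ := fun r s => ⟪gradient W (f r s), f' r s⟫_ℝ
  have hH : Integrable (Function.uncurry H) (slab T U) :=
    integrable_inner_of_memLp_two hP h.memLp_deriv
  -- the convexity bound gives one time at which the energy is finite
  obtain ⟨a, ha, hWa⟩ : ∃ a ∈ Ioo 0 T, IntegrableOn (fun s => W (f a s)) U := by
    have hPf : Integrable (Function.uncurry fun r s => ⟪gradient W (f r s), f r s⟫_ℝ) (slab T U) :=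
      integrable_inner_of_memLp_two hP h.memLp
    have hae : ∀ᵐ t ∂(volume.restrict (Ioo 0 T)), t ∈ Ioo 0 T ∧
        IntegrableOn (fun s => W (f t s)) U := by
      filter_upwards [hPf.prod_right_ae, h.memLp.1.prodMk_left, ae_restrict_mem measurableSet_Ioo]
        with t h1 h2 h3
      refine ⟨h3, ?_⟩
      refine Integrable.mono' ((integrable_const (W 0)).add h1)
        (hW.continuous.comp_aestronglyMeasurable h2) (ae_of_all _ fun s => ?_)
      rw [Real.norm_of_nonneg (hpos _)]
      have := add_fderiv_le_of_convexOn (hW.differentiable (by norm_num)) hconv (f t s) 0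
      rw [zero_sub, map_neg, hgrad] at this
      simp only [Pi.add_apply, Function.uncurry_apply_pair]
      linarith
    have : (ae (volume.restrict (Ioo 0 T))).NeBot := by
      rw [ae_restrict_neBot, Real.volume_Ioo]
      simpa using hT
    exact hae.exists
  have hatIco := Ioo_subset_Ico_self ha
  have key : ∀ t ∈ Ico 0 T, ∀ᵐ s ∂(volume.restrict U),
      W (f t s) = W (f a s) + ∫ r in a..t, H r s := by
    intro t ht
    filter_upwards [h.ae_ae_eq hU, h.eq_integral t ht, h.eq_integral a hatIco] with s h1 h2 h3
    obtain ⟨hi, he⟩ := h1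
    have hsub : uIcc a t ⊆ Ico 0 T := ordConnected_Ico.uIcc_subset hatIco ht
    have hi' : ∀ x ∈ Ico 0 T, ∀ y ∈ Ico 0 T, IntervalIntegrable (fun r => f' r s) volume x y := by
      have : IntervalIntegrable (fun r => f' r s) volume 0 T := by
        rwa [intervalIntegrable_iff_integrableOn_Ioo_of_le hT.le]
      intro x hx y hy
      refine this.mono_set ?_
      rw [uIcc_of_le hT.le]
      exact (ordConnected_Ico.uIcc_subset hx hy).trans Ico_subset_Icc_self
    have h0 : (0 : ℝ) ∈ Ico 0 T := ⟨le_rfl, hT⟩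
    let z : ℝ → E := fun r => f 0 s + ∫ ρ in 0..r, f' ρ s
    have := sub_eq_integral_fderiv_comp hW (z := z) (hi' a hatIco t ht) (fun x hx => by
      simp only [z]
      rw [add_assoc, intervalIntegral.integral_add_adjacent_intervals (hi' 0 h0 a hatIco)
        (hi' a hatIco x (hsub hx))])
    rw [h2, h3]
    change W (z t) = W (z a) + _
    rw [← sub_eq_iff_eq_add', this]
    refine intervalIntegral.integral_congr_ae ?_
    rw [ae_restrict_iff' measurableSet_Ioo] at he
    have hne : ∀ᵐ x : ℝ, x ≠ 0 := by simp [ae_iff, measure_singleton]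
    filter_upwards [he, hne] with r hr hr0 hrm
    have hrI := hsub (uIoc_subset_uIcc hrm)
    rw [hgrad]
    simp only [H, z, ← hr ⟨lt_of_le_of_ne hrI.1 hr0.symm, hrI.2⟩]
  have hHt : ∀ t ∈ Ico 0 T, Integrable (Function.uncurry H)
      ((volume.restrict (uIoc a t)).prod (volume.restrict U)) := by
    intro t ht
    refine hH.mono_measure ?_
    unfold slab
    exact Measure.prod_mono
      (Measure.restrict_mono (uIoc_subset_Ioo_of_mem_Ico hatIco ht) le_rfl) le_rfl
  have hE : ∀ t ∈ Ico 0 T, IntegrableOn (fun s => W (f t s)) U ∧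
      ∫ s in U, W (f t s) = (∫ s in U, W (f a s)) + ∫ r in a..t, ∫ s in U, H r s := by
    intro t ht
    have hI : Integrable (fun s => ∫ r in a..t, H r s) (volume.restrict U) := by
      have := (hHt t ht).integral_prod_right
      simp_rw [intervalIntegral.intervalIntegral_eq_integral_uIoc]
      exact this.smul (if a ≤ t then (1 : ℝ) else -1)
    constructor
    · exact (hWa.add hI).congr ((key t ht).mono fun s hs => hs.symm)
    · rw [integral_congr_ae (key t ht), integral_add hWa hI]
      congr 1
      simp_rw [intervalIntegral.intervalIntegral_eq_integral_uIoc]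
      rw [integral_smul]
      congr 1
      exact (integral_integral_swap (hHt t ht)).symm
  have hac := absolutelyContinuous_of_eq_integral (φ := fun t => ∫ s in U, W (f t s))
    (e := fun r => ∫ s in U, H r s) hatIco hH.integral_prod_left fun t ht => (hE t ht).2
  refine ⟨fun t ht => ⟨?_, (hE t ht).1⟩, hac.1, hac.2⟩
  have hsm : AEStronglyMeasurable (fun s => f 0 s + ∫ ρ in 0..t, f' ρ s) (volume.restrict U) := by
    refine h.initial.1.add ?_
    have : AEStronglyMeasurable (Function.uncurry f')
        ((volume.restrict (uIoc 0 t)).prod (volume.restrict U)) := by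
      refine h.memLp_deriv.1.mono_measure ?_
      unfold slab
      exact Measure.prod_mono
        (Measure.restrict_mono (uIoc_subset_Ioo_of_mem_Ico ⟨le_rfl, hT⟩ ht) le_rfl) le_rfl
    simp_rw [intervalIntegral.intervalIntegral_eq_integral_uIoc]
    exact (this.prod_swap.integral_prod_right').const_smul _
  exact hsm.congr ((h.eq_integral t ht).mono fun s hs => hs.symm)

/-! ### Steklov averages -/

theorem eLpNorm_two_sq {α E : Type*} [MeasurableSpace α] [NormedAddCommGroup E] (μ : Measure α)
    (f : α → E) : eLpNorm f 2 μ ^ 2 = ∫⁻ x, ‖f x‖ₑ ^ 2 ∂μ := by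
  have := eLpNorm_nnreal_pow_eq_lintegral (f := f) (μ := μ) (p := 2) (by norm_num)
  simpa using this

/-- Translations act continuously on `Lᵖ`: `g(· - s) → g` in `L²(ℝ;E)` as `s → 0`. -/
theorem tendsto_eLpNorm_translate_sub {E : Type*} [NormedAddCommGroup E] {g : ℝ → E}
    (hg : MemLp g 2 volume) :
    Tendsto (fun s : ℝ => eLpNorm (fun t => g (t - s) - g t) 2 volume) (𝓝 0) (𝓝 0) := by
  let τ : C(ℝ, C(ℝ, ℝ)) := (ContinuousMap.mk (fun a : ℝ × ℝ => a.2 - a.1) (by fun_prop)).curry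
  have hτ : ∀ s, MeasurePreserving (τ s) volume volume := fun s =>
    measurePreserving_sub_right volume s
  have hc : Continuous fun s => Lp.compMeasurePreserving (τ s) (hτ s) (hg.toLp g) :=
    Continuous.compMeasurePreservingLp continuous_const τ.continuous hτ (by norm_num)
  have h0 : Lp.compMeasurePreserving (τ 0) (hτ 0) (hg.toLp g) = hg.toLp g := by
    rw [Lp.toLp_compMeasurePreserving]
    congr 1
    ext t
    simp [τ]
  have := (hc.tendsto 0)
  rw [h0, tendsto_iff_edist_tendsto_0] at this
  refine this.congr fun s => ?_
  rw [Lp.toLp_compMeasurePreserving, Lp.edist_toLp_toLp]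
  rfl

theorem intervalIntegrable_of_memLp_two {E : Type*} [NormedAddCommGroup E] {g : ℝ → E}
    (hg : MemLp g 2 volume) (a b : ℝ) : IntervalIntegrable g volume a b :=
  ((hg.locallyIntegrable (by norm_num)).integrableOn_isCompact isCompact_uIcc).intervalIntegrable

/-- The Steklov average of `g` over `[t - h, t]`. It looks only into the past, so that it is
defined up to the right end of a time interval. -/
def steklov {E : Type*} [NormedAddCommGroup E] [NormedSpace ℝ E] (h : ℝ) (g : ℝ → E) (t : ℝ) : E :=
  h⁻¹ • ∫ r in (t - h)..t, g r

section steklov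

variable {E : Type*} [NormedAddCommGroup E] [NormedSpace ℝ E]

theorem steklov_eq_integral_unit (h : ℝ) (hh : 0 < h) (g : ℝ → E) (t : ℝ) :
    steklov h g t = ∫ θ in Ioc (0 : ℝ) 1, g (t - h * θ) := by
  rw [← intervalIntegral.integral_of_le zero_le_one,
    intervalIntegral.integral_comp_sub_mul (f := g) hh.ne' t]
  simp [steklov]

theorem continuous_steklov {g : ℝ → E} (hg : ∀ a b, IntervalIntegrable g volume a b) (h : ℝ) :
    Continuous (steklov h g) := by
  have h1 : steklov h g = fun t => h⁻¹ • ((∫ r in 0..t, g r) - ∫ r in 0..(t - h), g r) := by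
    ext t
    rw [steklov, intervalIntegral.integral_interval_sub_left (hg _ _) (hg _ _)]
  rw [h1]
  have h2 := intervalIntegral.continuous_primitive hg 0
  fun_prop

theorem steklov_congr_ae {g g' : ℝ → E} (h : g =ᵐ[volume] g') (η : ℝ) :
    steklov η g = steklov η g' := by
  ext t
  rw [steklov, steklov, intervalIntegral.integral_congr_ae (h.mono fun x hx _ => hx)]

/-- By Jensen's inequality the average is no further from `g` than the translates it averages. -/
theorem tendsto_eLpNorm_steklov_sub [CompleteSpace E] {g : ℝ → E} (hg : MemLp g 2 volume) :
    Tendsto (fun h : ℝ => eLpNorm (fun t => steklov h g t - g t) 2 volume) (𝓝[>] 0) (𝓝 0) := by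
  wlog hsm : StronglyMeasurable g generalizing g
  · have := this ((memLp_congr_ae hg.1.ae_eq_mk).1 hg) hg.1.stronglyMeasurable_mk
    refine this.congr fun h => ?_
    rw [← steklov_congr_ae hg.1.ae_eq_mk]
    refine eLpNorm_congr_ae ?_
    filter_upwards [hg.1.ae_eq_mk] with t ht
    rw [ht]
  have key : ∀ h : ℝ, 0 < h → eLpNorm (fun t => steklov h g t - g t) 2 volume ^ 2 ≤
      ∫⁻ θ in Ioc (0 : ℝ) 1, eLpNorm (fun t => g (t - h * θ) - g t) 2 volume ^ 2 := by
    intro h hh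
    have : IsProbabilityMeasure (volume.restrict (Ioc (0 : ℝ) 1)) := ⟨by simp⟩
    have hm : StronglyMeasurable fun p : ℝ × ℝ => g (p.1 - h * p.2) - g p.1 :=
      (hsm.comp_measurable (by fun_prop)).sub (hsm.comp_measurable measurable_fst)
    simp_rw [eLpNorm_two_sq]
    rw [lintegral_lintegral_swap]
    swap
    · exact ((hm.enorm.pow_const 2).comp measurable_swap).aemeasurable
    refine lintegral_mono fun t => ?_
    have hi : Integrable (fun θ => g (t - h * θ)) (volume.restrict (Ioc (0 : ℝ) 1)) := by
      have := ((intervalIntegrable_of_memLp_two hg (t - h) t).comp_sub_left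
        t).comp_mul_left (c := h)
      rw [sub_sub_cancel, sub_self, div_self hh.ne', zero_div] at this
      exact (intervalIntegrable_iff_integrableOn_Ioc_of_le zero_le_one).1 this.symm
    have e1 : steklov h g t - g t = ∫ θ in Ioc (0 : ℝ) 1, (g (t - h * θ) - g t) := by
      rw [integral_sub hi (integrable_const _), steklov_eq_integral_unit h hh]
      simp
    have e2 : ‖steklov h g t - g t‖ₑ ≤
        eLpNorm (fun θ => g (t - h * θ) - g t) 2 (volume.restrict (Ioc (0 : ℝ) 1)) := by
      rw [e1]
      refine (enorm_integral_le_lintegral_enorm _).trans ?_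
      rw [← eLpNorm_one_eq_lintegral_enorm]
      exact eLpNorm_le_eLpNorm_of_exponent_le (by norm_num)
        (hm.comp_measurable measurable_prodMk_left).aestronglyMeasurable
    exact (pow_le_pow_left' e2 2).trans (eLpNorm_two_sq _ _).le
  have hlim : Tendsto (fun s : ℝ => eLpNorm (fun t => g (t - s) - g t) 2 volume) (𝓝 0) (𝓝 0) :=
    tendsto_eLpNorm_translate_sub hg
  rw [ENNReal.tendsto_nhds_zero] at hlim ⊢
  intro ε hε
  obtain ⟨δ, hδ, H⟩ := Metric.eventually_nhds_iff.1 (hlim ε hε)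
  filter_upwards [Ioo_mem_nhdsGT hδ] with h hh
  have : eLpNorm (fun t => steklov h g t - g t) 2 volume ^ 2 ≤ ε ^ 2 := by
    refine (key h hh.1).trans ?_
    calc _ ≤ ∫⁻ θ in Ioc (0 : ℝ) 1, ε ^ 2 := by
          refine setLIntegral_mono' measurableSet_Ioc fun θ hθ => ?_
          refine pow_le_pow_left' (H ?_) 2
          rw [dist_zero_right, Real.norm_of_nonneg (mul_nonneg hh.1.le hθ.1.le)]
          exact (mul_le_of_le_one_right hh.1.le hθ.2).trans_lt hh.2
      _ = _ := by simp
  exact (ENNReal.pow_le_pow_left_iff two_ne_zero).1 this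

theorem steklov_eq_add_integral [CompleteSpace E] {g : ℝ → E}
    (hg : ∀ a b, IntervalIntegrable g volume a b) (h t : ℝ) :
    steklov h g t = steklov h g 0 + ∫ r in 0..t, h⁻¹ • (g r - g (r - h)) := by
  have h1 : IntervalIntegrable (fun r => g (r - h)) volume 0 t := by
    simpa using (hg (0 - h) (t - h)).comp_sub_right h
  rw [intervalIntegral.integral_smul, intervalIntegral.integral_sub (hg _ _) h1,
    intervalIntegral.integral_comp_sub_right, steklov, steklov, ← smul_add]
  congr 1
  have e1 := intervalIntegral.integral_add_adjacent_intervals (hg (t - h) 0) (hg 0 t)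
  have e2 := intervalIntegral.integral_add_adjacent_intervals (hg (0 - h) (t - h)) (hg (t - h) 0)
  rw [← e1, ← e2]
  abel

theorem tendsto_steklov_of_continuous [CompleteSpace E] {g : ℝ → E} (hg : Continuous g) (t : ℝ) :
    Tendsto (fun h => steklov h g t) (𝓝[>] 0) (𝓝 (g t)) := by
  have h1 : HasDerivAt (fun x => ∫ r in t..x, g r) (g t) t :=
    intervalIntegral.integral_hasDerivAt_right (by simp) (hg.stronglyMeasurableAtFilter _ _)
      hg.continuousAt
  rw [hasDerivAt_iff_tendsto_slope_zero] at h1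
  have h2 : Tendsto (fun h : ℝ => -h) (𝓝[>] 0) (𝓝[≠] 0) := by
    refine tendsto_nhdsWithin_iff.2 ⟨?_, ?_⟩
    · simpa using (tendsto_neg (0 : ℝ)).mono_left nhdsWithin_le_nhds
    · filter_upwards [self_mem_nhdsWithin] with h hh
      simpa using (mem_Ioi.1 hh).ne'
  refine (h1.comp h2).congr fun h => ?_
  simp only [Function.comp_apply, intervalIntegral.integral_same, sub_zero, steklov]
  rw [intervalIntegral.integral_symm, inv_neg, smul_neg, neg_smul, neg_neg, ← sub_eq_add_neg]

theorem map_steklov [CompleteSpace E] {F : Type*} [NormedAddCommGroup F] [NormedSpace ℝ F]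
    [CompleteSpace F] (L : E →L[ℝ] F)
    {g : ℝ → E} (hg : ∀ a b, IntervalIntegrable g volume a b) (h t : ℝ) :
    L (steklov h g t) = steklov h (fun r => L (g r)) t := by
  rw [steklov, steklov, map_smul, L.intervalIntegral_comp_comm (hg _ _)]

end steklov

/-! ### The energy equality of Lions and Magenes -/

theorem intervalIntegrable_clm_comp {E F : Type*} [NormedAddCommGroup E] [NormedSpace ℝ E]
    [NormedAddCommGroup F] [NormedSpace ℝ F] (L : E →L[ℝ] F) {g : ℝ → E} {a b : ℝ}
    (hg : IntervalIntegrable g volume a b) : IntervalIntegrable (fun r => L (g r)) volume a b :=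
  ⟨L.integrable_comp hg.1, L.integrable_comp hg.2⟩

theorem steklov_mem {E : Type*} [NormedAddCommGroup E] [InnerProductSpace ℝ E] [CompleteSpace E]
    {V : Submodule ℝ E} (hV : IsClosed (V : Set E)) {g : ℝ → E}
    (hg : ∀ a b, IntervalIntegrable g volume a b) (hgV : ∀ᵐ t, g t ∈ V) (h t : ℝ) :
    steklov h g t ∈ V := by
  have : CompleteSpace V := hV.completeSpace_coe
  rw [← V.orthogonal_orthogonal, Submodule.mem_orthogonal]
  intro u hu
  have h1 := map_steklov (innerSL ℝ u) hg h t
  rw [innerSL_apply_apply] at h1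
  rw [h1, steklov_congr_ae (g' := fun _ => (0 : ℝ))]
  · simp [steklov]
  · filter_upwards [hgV] with r hr
    exact Submodule.inner_left_of_mem_orthogonal hr hu

theorem norm_sq_eq_add_integral_inner {H : Type*} [NormedAddCommGroup H] [InnerProductSpace ℝ H]
    [CompleteSpace H] {z z' : ℝ → H} {a b : ℝ} (hz' : IntervalIntegrable z' volume a b)
    (hz : ∀ t ∈ uIcc a b, z t = z a + ∫ r in a..t, z' r) :
    ‖z b‖ ^ 2 = ‖z a‖ ^ 2 + 2 * ∫ r in a..b, ⟪z' r, z r⟫_ℝ := by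
  have := sub_eq_integral_fderiv_comp (W := fun x : H => ‖x‖ ^ 2) (contDiff_norm_sq ℝ) hz' hz
  rw [← sub_eq_iff_eq_add', this, ← intervalIntegral.integral_const_mul]
  refine intervalIntegral.integral_congr fun r _ => ?_
  rw [fderiv_norm_sq_apply, real_inner_comm]
  simp

theorem tendsto_integral_inner {α ι E : Type*} [MeasurableSpace α] {μ : Measure α}
    [NormedAddCommGroup E] [InnerProductSpace ℝ E] {l : Filter ι} {a b : ι → α → E} {a' b' : α → E}
    (ha : ∀ i, MemLp (a i) 2 μ) (hb : ∀ i, MemLp (b i) 2 μ) (ha' : MemLp a' 2 μ)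
    (hb' : MemLp b' 2 μ)
    (hta : Tendsto (fun i => eLpNorm (fun x => a i x - a' x) 2 μ) l (𝓝 0))
    (htb : Tendsto (fun i => eLpNorm (fun x => b i x - b' x) 2 μ) l (𝓝 0)) :
    Tendsto (fun i => ∫ x, ⟪a i x, b i x⟫_ℝ ∂μ) l (𝓝 (∫ x, ⟪a' x, b' x⟫_ℝ ∂μ)) := by
  have hLp : ∀ {f g : α → E} (hf : MemLp f 2 μ) (hg : MemLp g 2 μ),
      ∫ x, ⟪f x, g x⟫_ℝ ∂μ = ⟪hf.toLp f, hg.toLp g⟫_ℝ := fun hf hg => by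
    rw [L2.inner_def]
    refine integral_congr_ae ?_
    filter_upwards [hf.coeFn_toLp, hg.coeFn_toLp] with x h1 h2
    rw [h1, h2]
  have hT : ∀ {f : ι → α → E} {f' : α → E} (hf : ∀ i, MemLp (f i) 2 μ) (hf' : MemLp f' 2 μ),
      Tendsto (fun i => eLpNorm (fun x => f i x - f' x) 2 μ) l (𝓝 0) →
      Tendsto (fun i => (hf i).toLp (f i)) l (𝓝 (hf'.toLp f')) := fun hf hf' h => by
    rw [tendsto_iff_edist_tendsto_0]
    refine h.congr fun i => ?_
    rw [Lp.edist_toLp_toLp]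
    rfl
  simp_rw [hLp (ha _) (hb _), hLp ha' hb']
  exact (hT ha ha' hta).inner (hT hb hb' htb)

/-- The energy equality for data on the whole line. `U` is constant before time `0`, so that all
its Steklov averages start from the same value; the squared norm of a difference of averages is
then controlled by averages of `W` and `U` alone, and these converge in `L²`. -/
theorem norm_sq_eq_of_weak_deriv_line {𝓔 H : Type*} [NormedAddCommGroup 𝓔] [InnerProductSpace ℝ 𝓔]
    [CompleteSpace 𝓔] [NormedAddCommGroup H] [InnerProductSpace ℝ H] [CompleteSpace H]
    (π : 𝓔 →L[ℝ] H) {V : Submodule ℝ 𝓔} (hVc : IsClosed (V : Set 𝓔))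
    (hdense : ∀ y : H, (∀ v ∈ V, ⟪y, π v⟫_ℝ = 0) → y = 0) {T : ℝ} {U W : ℝ → 𝓔}
    (hU : MemLp U 2 volume) (hW : MemLp W 2 volume) (hUV : ∀ᵐ t, U t ∈ V)
    {v₀ : 𝓔} (hU0 : ∀ᵐ r, r ∈ Ioc (-1) 0 → U r = v₀)
    (heq : ∀ᵐ r, r ∈ Ioo (-1) T → ∀ v ∈ V,
      ⟪π (U r), π v⟫_ℝ = ⟪π v₀, π v⟫_ℝ + ∫ ρ in 0..r, ⟪W ρ, v⟫_ℝ)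
    {t : ℝ} (ht : t ∈ Ico 0 T) {y : H}
    (hy : ∀ v ∈ V, ⟪y, π v⟫_ℝ = ⟪π v₀, π v⟫_ℝ + ∫ ρ in 0..t, ⟪W ρ, v⟫_ℝ) :
    ‖y‖ ^ 2 = ‖π v₀‖ ^ 2 + 2 * ∫ r in 0..t, ⟪W r, U r⟫_ℝ := by
  have iU := intervalIntegrable_of_memLp_two hU
  have iW := intervalIntegrable_of_memLp_two hW
  have iWv : ∀ v : 𝓔, ∀ a b, IntervalIntegrable (fun ρ => ⟪W ρ, v⟫_ℝ) volume a b := fun v a b => by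
    have := intervalIntegrable_clm_comp (innerSL ℝ v) (iW a b)
    simpa [real_inner_comm] using this
  let h : ℕ → ℝ := fun n => 1 / ((n : ℝ) + 1)
  have hpos : ∀ n, 0 < h n := fun n => Nat.one_div_pos_of_nat
  have hle : ∀ n, h n ≤ 1 := fun n => by
    rw [div_le_one (by positivity)]; linarith [n.cast_nonneg (α := ℝ)]
  have hlim : Tendsto h atTop (𝓝[>] 0) :=
    tendsto_nhdsWithin_iff.2 ⟨tendsto_one_div_add_atTop_nhds_zero_nat, Eventually.of_forall hpos⟩
  let Uh : ℕ → ℝ → 𝓔 := fun n => steklov (h n) U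
  let Wh : ℕ → ℝ → 𝓔 := fun n => steklov (h n) W
  let Z : ℕ → ℝ → H := fun n r => (h n)⁻¹ • (π (U r) - π (U (r - h n)))
  have hUhV : ∀ n r, Uh n r ∈ V := fun n r => steklov_mem hVc iU hUV _ _
  have hiZ : ∀ n a b, IntervalIntegrable (Z n) volume a b := fun n a b => by
    have h1 : IntervalIntegrable (fun r => U (r - h n)) volume a b := by
      simpa using (iU (a - h n) (b - h n)).comp_sub_right (h n)
    exact ((intervalIntegrable_clm_comp π (iU a b)).sub (intervalIntegrable_clm_comp π h1)).smul _
  have hUh0 : ∀ n, Uh n 0 = v₀ := fun n => by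
    simp only [Uh, steklov]
    rw [intervalIntegral.integral_congr_ae (g := fun _ => v₀)]
    · simp [smul_smul, (hpos n).ne']
    · filter_upwards [hU0] with r hr hrm
      rw [uIoc_of_le (by linarith [hpos n])] at hrm
      exact hr ⟨by linarith [hrm.1, hle n], hrm.2⟩
  have hUhZ : ∀ n r, π (Uh n r) = π v₀ + ∫ ρ in 0..r, Z n ρ := fun n r => by
    have h1 : ∀ a b, IntervalIntegrable (fun r => π (U r)) volume a b := fun a b =>
      intervalIntegrable_clm_comp π (iU a b)
    rw [← hUh0 n]
    simp only [Uh]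
    rw [map_steklov π iU, map_steklov π iU, steklov_eq_add_integral h1]
  have hZW : ∀ n, ∀ᵐ r, r ∈ Ioo 0 T → ∀ v ∈ V, ⟪Z n r, π v⟫_ℝ = ⟪Wh n r, v⟫_ℝ := fun n => by
    have hshift : ∀ᵐ r, r - h n ∈ Ioo (-1) T → ∀ v ∈ V, ⟪π (U (r - h n)), π v⟫_ℝ =
        ⟪π v₀, π v⟫_ℝ + ∫ ρ in 0..(r - h n), ⟪W ρ, v⟫_ℝ :=
      (measurePreserving_sub_right volume (h n)).quasiMeasurePreserving.ae heq
    filter_upwards [heq, hshift] with r h1 h2 hr v hv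
    have e1 := h1 ⟨by linarith [hr.1], hr.2⟩ v hv
    have e2 := h2 ⟨by linarith [hr.1, hle n], by linarith [hr.2, hpos n]⟩ v hv
    have e3 := map_steklov (innerSL ℝ v) iW (h n) r
    rw [innerSL_apply_apply, real_inner_comm] at e3
    simp only [Z, Wh]
    rw [e3, inner_smul_left, inner_sub_left, e1, e2, add_sub_add_left_eq_sub,
      intervalIntegral.integral_interval_sub_left (iWv v _ _) (iWv v _ _)]
    simp [steklov, real_inner_comm]
  have hsub : ∀ r ∈ uIoc 0 t, r ∈ Ioo 0 T := fun r hr =>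
    uIoc_subset_Ioo_of_mem_Ico ⟨le_rfl, ht.1.trans_lt ht.2⟩ ht hr
  -- the averages are absolutely continuous with values in `H`, so the chain rule applies to them
  have hnorm : ∀ n, ‖π (Uh n t)‖ ^ 2 = ‖π v₀‖ ^ 2 + 2 * ∫ r in 0..t, ⟪Wh n r, Uh n r⟫_ℝ := by
    intro n
    have := norm_sq_eq_add_integral_inner (z := fun r => π (Uh n r)) (hiZ n 0 t)
      (fun r _ => by rw [hUhZ n r, hUh0])
    rw [this, hUh0]
    congr 2
    refine intervalIntegral.integral_congr_ae ?_
    filter_upwards [hZW n] with r hr hrm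
    exact hr (hsub r hrm) _ (hUhV n r)
  have hdiff : ∀ n m, ‖π (Uh n t) - π (Uh m t)‖ ^ 2 =
      2 * ∫ r in 0..t, ⟪Wh n r - Wh m r, Uh n r - Uh m r⟫_ℝ := by
    intro n m
    have := norm_sq_eq_add_integral_inner (z := fun r => π (Uh n r) - π (Uh m r))
      ((hiZ n 0 t).sub (hiZ m 0 t))
      (fun r _ => by
        rw [hUhZ n r, hUhZ m r, hUh0, hUh0, intervalIntegral.integral_sub (hiZ n 0 r) (hiZ m 0 r)]
        abel)
    rw [this, hUh0, hUh0, sub_self, norm_zero, zero_pow two_ne_zero, zero_add]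
    congr 1
    refine intervalIntegral.integral_congr_ae ?_
    filter_upwards [hZW n, hZW m] with r hr hr' hrm
    have hv := V.sub_mem (hUhV n r) (hUhV m r)
    rw [← map_sub, inner_sub_left, inner_sub_left, hr (hsub r hrm) _ hv, hr' (hsub r hrm) _ hv]
  -- convergence of the averages in `L²(0,t)`
  let μ : Measure ℝ := volume.restrict (Ioc 0 t)
  have hconv : ∀ {g : ℝ → 𝓔}, MemLp g 2 volume →
      Tendsto (fun n => eLpNorm (fun r => steklov (h n) g r - g r) 2 μ) atTop (𝓝 0) := fun hg =>
    tendsto_of_tendsto_of_tendsto_of_le_of_le tendsto_const_nhds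
      ((tendsto_eLpNorm_steklov_sub hg).comp hlim) (fun _ => zero_le)
      (fun n => eLpNorm_mono_measure _ Measure.restrict_le_self)
  have hmem : ∀ {g : ℝ → 𝓔}, MemLp g 2 volume → ∀ n, MemLp (steklov (h n) g) 2 μ := fun hg n => by
    have hc := continuous_steklov (intervalIntegrable_of_memLp_two hg) (h n)
    obtain ⟨C, hC⟩ := (isCompact_Icc (a := 0) (b := t)).exists_bound_of_continuousOn hc.continuousOn
    refine MemLp.of_bound hc.aestronglyMeasurable C ?_
    filter_upwards [ae_restrict_mem measurableSet_Ioc] with r hr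
    exact hC r (Ioc_subset_Icc_self hr)
  have hI : Tendsto (fun n => ∫ r in 0..t, ⟪Wh n r, Uh n r⟫_ℝ) atTop
      (𝓝 (∫ r in 0..t, ⟪W r, U r⟫_ℝ)) := by
    simp_rw [intervalIntegral.integral_of_le ht.1]
    exact tendsto_integral_inner (hmem hW) (hmem hU) (hW.mono_measure Measure.restrict_le_self)
      (hU.mono_measure Measure.restrict_le_self) (hconv hW) (hconv hU)
  have hcauchy : CauchySeq fun n => π (Uh n t) := by
    rw [cauchySeq_iff_tendsto_dist_atTop_0]
    have hpair : ∀ {g : ℝ → 𝓔}, MemLp g 2 volume → Tendsto (fun p : ℕ × ℕ =>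
        eLpNorm (fun r => (steklov (h p.1) g r - steklov (h p.2) g r) - 0) 2 μ) atTop (𝓝 0) := by
      intro g hg
      have h1 := (hconv hg).comp (tendsto_fst (f := atTop) (g := (atTop : Filter ℕ)))
      have h2 := (hconv hg).comp (tendsto_snd (f := (atTop : Filter ℕ)) (g := atTop))
      have h3 := h1.add h2
      rw [add_zero, prod_atTop_atTop_eq] at h3
      refine tendsto_of_tendsto_of_tendsto_of_le_of_le tendsto_const_nhds h3 (fun _ => zero_le)
        fun p => ?_
      have hm : ∀ n, AEStronglyMeasurable (fun r => steklov (h n) g r - g r) μ := fun n =>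
        (hmem hg n).1.sub hg.1.restrict
      refine le_trans (le_of_eq ?_) (eLpNorm_sub_le (hm p.1) (hm p.2) (by norm_num))
      congr 1
      ext r
      simp
    have h0 : Tendsto (fun p : ℕ × ℕ => ∫ r in 0..t, ⟪Wh p.1 r - Wh p.2 r, Uh p.1 r - Uh p.2 r⟫_ℝ)
        atTop (𝓝 0) := by
      simp_rw [intervalIntegral.integral_of_le ht.1]
      have := tendsto_integral_inner (μ := μ) (l := atTop)
        (a := fun p : ℕ × ℕ => fun r => Wh p.1 r - Wh p.2 r)
        (b := fun p : ℕ × ℕ => fun r => Uh p.1 r - Uh p.2 r) (a' := fun _ => 0) (b' := fun _ => 0)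
        (fun p => (hmem hW p.1).sub (hmem hW p.2)) (fun p => (hmem hU p.1).sub (hmem hU p.2))
        MemLp.zero' MemLp.zero' (hpair hW) (hpair hU)
      simpa using this
    have h4 : Tendsto (fun p : ℕ × ℕ => dist (π (Uh p.1 t)) (π (Uh p.2 t)) ^ 2) atTop (𝓝 0) := by
      simp_rw [dist_eq_norm, hdiff]
      simpa using h0.const_mul 2
    have h5 := h4.sqrt
    simpa [Real.sqrt_sq dist_nonneg] using h5
  obtain ⟨L, hL⟩ := cauchySeq_tendsto_of_complete hcauchy
  -- the limit is `y`: both have the same products with the elements of `V`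
  have hLy : L = y := by
    rw [← sub_eq_zero]
    refine hdense _ fun v hv => ?_
    rw [inner_sub_left, sub_eq_zero]
    refine tendsto_nhds_unique (hL.inner tendsto_const_nhds) ?_
    let κ : ℝ → ℝ := fun r => ⟪π v₀, π v⟫_ℝ + ∫ ρ in 0..r, ⟪W ρ, v⟫_ℝ
    have hκ : Continuous κ :=
      continuous_const.add (intervalIntegral.continuous_primitive (iWv v) 0)
    have h1 := (tendsto_steklov_of_continuous hκ t).comp hlim
    rw [show κ t = ⟪y, π v⟫_ℝ from (hy v hv).symm] at h1
    refine h1.congr fun n => ?_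
    have h2 := map_steklov ((innerSL ℝ (π v)).comp π) iU (h n) t
    rw [ContinuousLinearMap.comp_apply, innerSL_apply_apply, real_inner_comm] at h2
    simp only [Uh, Function.comp_apply]
    rw [h2, steklov, steklov]
    congr 1
    refine intervalIntegral.integral_congr_ae ?_
    filter_upwards [heq] with r hr hrm
    rw [uIoc_of_le (by linarith [hpos n])] at hrm
    have := hr ⟨by linarith [hrm.1, hle n, ht.1], hrm.2.trans_lt ht.2⟩ v hv
    simp only [κ, ContinuousLinearMap.comp_apply, innerSL_apply_apply]
    rw [real_inner_comm (π (U r)), this]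
  rw [hLy] at hL
  refine tendsto_nhds_unique (hL.norm.pow 2) ?_
  simp_rw [hnorm]
  exact (hI.const_mul 2).const_add _

/-- The energy equality of Lions and Magenes. The values `uH t` are only prescribed by their
products with `π v`, `v ∈ V`; still `‖uH t‖²` obeys the equality at every `t`, not only at almost
every `t`, because `π V` is dense. -/
theorem norm_sq_eq_of_weak_deriv {𝓔 H : Type*} [NormedAddCommGroup 𝓔] [InnerProductSpace ℝ 𝓔]
    [CompleteSpace 𝓔] [NormedAddCommGroup H] [InnerProductSpace ℝ H] [CompleteSpace H]
    (π : 𝓔 →L[ℝ] H) {V : Submodule ℝ 𝓔} (hVc : IsClosed (V : Set 𝓔))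
    (hdense : ∀ y : H, (∀ v ∈ V, ⟪y, π v⟫_ℝ = 0) → y = 0) {T : ℝ} {u w : ℝ → 𝓔} {uH : ℝ → H}
    (hu : MemLp u 2 (volume.restrict (Ioo 0 T))) (hw : MemLp w 2 (volume.restrict (Ioo 0 T)))
    (huV : ∀ᵐ t ∂(volume.restrict (Ioo 0 T)), u t ∈ V)
    (huH : ∀ᵐ t ∂(volume.restrict (Ioo 0 T)), π (u t) = uH t)
    {v₀ : 𝓔} (hv₀ : v₀ ∈ V) (hv₀H : π v₀ = uH 0)
    (heq : ∀ v ∈ V, ∀ t ∈ Ico 0 T, ⟪uH t, π v⟫_ℝ = ⟪uH 0, π v⟫_ℝ + ∫ ρ in 0..t, ⟪w ρ, v⟫_ℝ)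
    {t : ℝ} (ht : t ∈ Ico 0 T) :
    ‖uH t‖ ^ 2 = ‖uH 0‖ ^ 2 + 2 * ∫ r in 0..t, ⟪w r, u r⟫_ℝ := by
  let U : ℝ → 𝓔 := (Ioc (-1) 0).indicator (fun _ => v₀) + (Ioo 0 T).indicator u
  let W : ℝ → 𝓔 := (Ioo 0 T).indicator w
  have hU : MemLp U 2 volume :=
    (memLp_indicator_const 2 measurableSet_Ioc v₀ (Or.inr (by simp))).add
      ((memLp_indicator_iff_restrict measurableSet_Ioo).2 hu)
  have hW : MemLp W 2 volume := (memLp_indicator_iff_restrict measurableSet_Ioo).2 hw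
  have U1 : ∀ r ∈ Ioc (-1 : ℝ) 0, U r = v₀ := fun r hr => by
    have : r ∉ Ioo 0 T := fun h => absurd h.1 (not_lt.2 hr.2)
    simp [U, hr, this]
  have U2 : ∀ r ∈ Ioo 0 T, U r = u r := fun r hr => by
    have : r ∉ Ioc (-1 : ℝ) 0 := fun h => absurd hr.1 (not_lt.2 h.2)
    simp [U, hr, this]
  have hWw : ∀ (F : 𝓔 → ℝ → ℝ), ∀ r ∈ Ico 0 T, ∫ ρ in 0..r, F (W ρ) ρ = ∫ ρ in 0..r, F (w ρ) ρ := by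
    intro F r hr
    refine intervalIntegral.integral_congr_ae (ae_of_all _ fun ρ hρ => ?_)
    have := uIoc_subset_Ioo_of_mem_Ico ⟨le_rfl, hr.1.trans_lt hr.2⟩ hr hρ
    simp [W, this]
  rw [ae_restrict_iff' measurableSet_Ioo] at huV huH
  have := norm_sq_eq_of_weak_deriv_line π hVc hdense hU hW (v₀ := v₀) (T := T) ?_
    (ae_of_all _ U1) ?_ ht (y := uH t) ?_
  · rw [this, hv₀H, hWw (fun x r => ⟪x, U r⟫_ℝ) t ht]
    congr 2
    refine intervalIntegral.integral_congr_ae (ae_of_all _ fun ρ hρ => ?_)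
    rw [U2 ρ (uIoc_subset_Ioo_of_mem_Ico ⟨le_rfl, ht.1.trans_lt ht.2⟩ ht hρ)]
  · filter_upwards [huV] with r hr
    by_cases h1 : r ∈ Ioo 0 T
    · rw [U2 r h1]; exact hr h1
    · by_cases h2 : r ∈ Ioc (-1 : ℝ) 0
      · rw [U1 r h2]; exact hv₀
      · simp [U, h1, h2]
  · filter_upwards [huH] with r hr hrm v hv
    rcases le_or_gt r 0 with h | h
    · rw [U1 r ⟨hrm.1, h⟩]
      rw [intervalIntegral.integral_congr_ae (g := fun _ => (0 : ℝ))]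
      · simp
      · refine ae_of_all _ fun ρ hρ => ?_
        rw [uIoc_of_ge h] at hρ
        have : ρ ∉ Ioo 0 T := fun h' => absurd h'.1 (not_lt.2 hρ.2)
        simp [W, this]
    · rw [U2 r ⟨h, hrm.2⟩, hr ⟨h, hrm.2⟩, hWw (fun x _ => ⟪x, v⟫_ℝ) r ⟨h.le, hrm.2⟩, hv₀H]
      exact heq v hv r ⟨h.le, hrm.2⟩
  · intro v hv
    rw [hWw (fun x _ => ⟪x, v⟫_ℝ) t ht, hv₀H]
    exact heq v hv t ht

/-- In a separable space the open sets are countable unions of balls. -/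
theorem measurable_of_measurable_edist {α X : Type*} [MeasurableSpace α] [PseudoEMetricSpace X]
    [SecondCountableTopology X] [MeasurableSpace X] [BorelSpace X] {F : α → X}
    (h : ∀ y, Measurable fun a => edist (F a) y) : Measurable F := by
  refine measurable_of_isOpen fun O hO => ?_
  choose! r hr hrO using fun x (hx : x ∈ O) => EMetric.isOpen_iff.1 hO x hx
  obtain ⟨c, hcO, hc, hcU⟩ := TopologicalSpace.isOpen_biUnion_countable O
    (fun x => Metric.eball x (r x)) (fun x _ => Metric.isOpen_eball)
  have hO' : O = ⋃ x ∈ c, Metric.eball x (r x) := by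
    rw [hcU]
    exact Subset.antisymm (fun x hx => mem_biUnion hx (Metric.mem_eball_self (hr x hx)))
      (iUnion₂_subset hrO)
  rw [hO', preimage_iUnion₂]
  exact MeasurableSet.biUnion hc fun x _ => measurableSet_lt (h x) measurable_const

/-- A square integrable function on a product is a square integrable function of the first variable
with values in `L²` of the second. -/
theorem exists_memLp_two_curry {α β E : Type*} [MeasurableSpace α] [MeasurableSpace β]
    [NormedAddCommGroup E] [SecondCountableTopology E] {μ : Measure α} {ν : Measure β}
    [SFinite μ] [SFinite ν] [IsSeparable ν] {f : α → β → E}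
    (hf : MemLp (Function.uncurry f) 2 (μ.prod ν)) :
    ∃ F : α → Lp E 2 ν, MemLp F 2 μ ∧ ∀ᵐ a ∂μ, F a =ᵐ[ν] f a := by
  classical
  set g := hf.1.mk _ with hg
  have mg : StronglyMeasurable g := hf.1.stronglyMeasurable_mk
  have efg : ∀ᵐ p ∂(μ.prod ν), f p.1 p.2 = g p := hf.1.ae_eq_mk
  have hgL : MemLp g 2 (μ.prod ν) := (memLp_congr_ae hf.1.ae_eq_mk).1 hf
  have mga : ∀ a, StronglyMeasurable fun b => g (a, b) := fun a =>
    mg.comp_measurable measurable_prodMk_left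
  have mN : ∀ y : β → E, StronglyMeasurable y →
      Measurable fun a => eLpNorm (fun b => g (a, b) - y b) 2 ν := by
    intro y hy
    have h1 : Measurable fun a => ∫⁻ b, ‖g (a, b) - y b‖ₑ ^ 2 ∂ν := by
      refine Measurable.lintegral_prod_right' (f := fun p : α × β => ‖g p - y p.2‖ₑ ^ 2) ?_
      exact (mg.sub (hy.comp_measurable measurable_snd)).enorm.pow_const 2
    have h2 : ∀ a, eLpNorm (fun b => g (a, b) - y b) 2 ν =
        (∫⁻ b, ‖g (a, b) - y b‖ₑ ^ 2 ∂ν) ^ (1 / 2 : ℝ) := fun a => by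
      rw [← eLpNorm_two_sq, ← ENNReal.rpow_natCast, ← ENNReal.rpow_mul]
      norm_num
    simp_rw [h2]
    exact h1.pow_const _
  have mS : MeasurableSet {a | MemLp (fun b => g (a, b)) 2 ν} := by
    have : {a | MemLp (fun b => g (a, b)) 2 ν} = {a | eLpNorm (fun b => g (a, b) - 0) 2 ν < ⊤} := by
      ext a
      simp [MemLp, (mga a).aestronglyMeasurable]
    rw [this]
    exact measurableSet_lt (mN (fun _ => 0) stronglyMeasurable_const) measurable_const
  let F : α → Lp E 2 ν := fun a =>
    if h : MemLp (fun b => g (a, b)) 2 ν then h.toLp (fun b => g (a, b)) else 0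
  have hF : ∀ a (h : MemLp (fun b => g (a, b)) 2 ν), F a = h.toLp (fun b => g (a, b)) := fun a h =>
    dif_pos h
  have mF : StronglyMeasurable F := by
    have : Fact ((2 : ENNReal) ≠ ⊤) := ⟨by norm_num⟩
    borelize ↥(Lp E 2 ν)
    refine Measurable.stronglyMeasurable (measurable_of_measurable_edist fun y => ?_)
    have : (fun a => edist (F a) y) = fun a => if MemLp (fun b => g (a, b)) 2 ν then
        eLpNorm (fun b => g (a, b) - y b) 2 ν else edist 0 y := by
      ext a
      by_cases h : MemLp (fun b => g (a, b)) 2 ν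
      · rw [if_pos h, hF a h, Lp.edist_def]
        refine eLpNorm_congr_ae ?_
        filter_upwards [h.coeFn_toLp] with b hb
        rw [Pi.sub_apply, hb]
      · rw [if_neg h]
        simp only [F, dif_neg h]
    rw [this]
    exact Measurable.ite mS (mN y (Lp.stronglyMeasurable y)) measurable_const
  have eF : ∀ᵐ a ∂μ, MemLp (fun b => g (a, b)) 2 ν := by
    have h1 : ∫⁻ a, ∫⁻ b, ‖g (a, b)‖ₑ ^ 2 ∂ν ∂μ < ⊤ := by
      rw [← lintegral_prod _ (mg.enorm.pow_const 2).aemeasurable, ← eLpNorm_two_sq]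
      exact ENNReal.pow_lt_top hgL.2
    filter_upwards [ae_lt_top (Measurable.lintegral_prod_right' (mg.enorm.pow_const 2)) h1.ne]
      with a ha
    refine ⟨(mga a).aestronglyMeasurable, ?_⟩
    rw [← eLpNorm_two_sq] at ha
    exact (ENNReal.pow_lt_top_iff.1 ha).resolve_right (by norm_num)
  refine ⟨F, ⟨mF.aestronglyMeasurable, ?_⟩, ?_⟩
  · have h1 : eLpNorm F 2 μ ^ 2 = eLpNorm g 2 (μ.prod ν) ^ 2 := by
      rw [eLpNorm_two_sq, eLpNorm_two_sq, lintegral_prod _ (mg.enorm.pow_const 2).aemeasurable]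
      refine lintegral_congr_ae ?_
      filter_upwards [eF] with a ha
      rw [hF a ha, Lp.enorm_toLp, eLpNorm_two_sq]
    have h2 : eLpNorm F 2 μ ^ 2 < ⊤ := h1 ▸ ENNReal.pow_lt_top hgL.2
    exact (ENNReal.pow_lt_top_iff.1 h2).resolve_right (by norm_num)
  · filter_upwards [eF, Measure.ae_ae_of_ae_prod efg] with a h1 h2
    rw [hF a h1]
    filter_upwards [h1.coeFn_toLp, h2] with b h3 h4
    rw [h3, h4]

/-! ### The space `H¹₀(Ω)ᵈ` inside `L²(Ω)` -/

/-- Values of a field together with those of its gradient. The space `L²(Ω; Jet d)` contains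
`H¹(Ω)ᵈ` isometrically through `v ↦ (v, ∇v)`. -/
abbrev Jet (d : ℕ) := WithLp 2 (Vec d × Tensor d d)

/-- The pair `(v, Dv)` as a single field. -/
def jet {d : ℕ} {α : Type*} (v : α → Vec d) (Dv : α → Tensor d d) (x : α) : Jet d :=
  WithLp.toLp 2 (v x, Dv x)

section jet

variable {d : ℕ} {α : Type*}

theorem jet_eq_add (v : α → Vec d) (Dv : α → Tensor d d) :
    jet v Dv = (fun x => jet (d := d) (fun a : Vec d => a) (fun _ => 0) (v x)) +
      fun x => jet (d := d) (fun _ => 0) (fun a : Tensor d d => a) (Dv x) := by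
  ext1 x
  simp [jet, ← WithLp.toLp_add]

theorem norm_jet_left (a : Vec d) : ‖jet (d := d) (fun a : Vec d => a) (fun _ => 0) a‖ = ‖a‖ :=
  WithLp.norm_toLp_fst 2 _ _ a

theorem norm_jet_right (a : Tensor d d) :
    ‖jet (d := d) (fun _ => 0) (fun a : Tensor d d => a) a‖ = ‖a‖ :=
  WithLp.norm_toLp_snd 2 _ _ a

theorem continuous_jet_left : Continuous (jet (d := d) (fun a : Vec d => a) (fun _ => 0)) :=
  (WithLp.prod_continuous_toLp 2 _ _).comp (by fun_prop)

theorem continuous_jet_right :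
    Continuous (jet (d := d) (fun _ => 0) (fun a : Tensor d d => a)) :=
  (WithLp.prod_continuous_toLp 2 _ _).comp (by fun_prop)

variable [MeasurableSpace α] {μ : Measure α}

theorem memLp_jet {v : α → Vec d} {Dv : α → Tensor d d} (hv : MemLp v 2 μ) (hDv : MemLp Dv 2 μ) :
    MemLp (jet v Dv) 2 μ := by
  rw [jet_eq_add]
  exact (hv.of_le (continuous_jet_left.comp_aestronglyMeasurable hv.1)
      (ae_of_all _ fun x => (norm_jet_left _).le)).add
    (hDv.of_le (continuous_jet_right.comp_aestronglyMeasurable hDv.1)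
      (ae_of_all _ fun x => (norm_jet_right _).le))

theorem eLpNorm_jet_le {v : α → Vec d} {Dv : α → Tensor d d} (hv : AEStronglyMeasurable v μ)
    (hDv : AEStronglyMeasurable Dv μ) :
    eLpNorm (jet v Dv) 2 μ ≤ eLpNorm v 2 μ + eLpNorm Dv 2 μ := by
  rw [jet_eq_add]
  refine (eLpNorm_add_le (continuous_jet_left.comp_aestronglyMeasurable hv)
    (continuous_jet_right.comp_aestronglyMeasurable hDv) (by norm_num)).trans (le_of_eq ?_)
  congr 1
  · exact eLpNorm_congr_norm_ae (ae_of_all _ fun x => norm_jet_left _)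
  · exact eLpNorm_congr_norm_ae (ae_of_all _ fun x => norm_jet_right _)

end jet

theorem inner_eq_integral_of_ae {α E : Type*} [MeasurableSpace α] {μ : Measure α}
    [NormedAddCommGroup E] [InnerProductSpace ℝ E] {f g : Lp E 2 μ} {f' g' : α → E}
    (hf : f =ᵐ[μ] f') (hg : g =ᵐ[μ] g') : ⟪f, g⟫_ℝ = ∫ x, ⟪f' x, g' x⟫_ℝ ∂μ := by
  rw [L2.inner_def]
  refine integral_congr_ae ?_
  filter_upwards [hf, hg] with x h1 h2
  rw [h1, h2]

theorem continuous_grad {d m : ℕ} {φ : Vec m → Vec d} (hφ : ContDiff ℝ ∞ φ) :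
    Continuous (grad φ) := by
  have h : Continuous (fderiv ℝ φ) := hφ.continuous_fderiv (by simp)
  refine (PiLp.continuous_toLp 2 _).comp (continuous_pi fun ij => ?_)
  exact (PiLp.continuous_apply 2 _ ij.1).comp (h.clm_apply continuous_const)

theorem hasCompactSupport_grad {d m : ℕ} {φ : Vec m → Vec d} (hφ : HasCompactSupport φ) :
    HasCompactSupport (grad φ) := by
  have h := hφ.fderiv (𝕜 := ℝ)
  refine h.mono fun x hx => ?_
  contrapose! hx
  rw [Function.notMem_support] at hx ⊢
  ext ij
  simp [grad, hx]

theorem IsTest.isH10 {d : ℕ} {Ω : Set (Vec d)} {φ : Vec d → Vec d} (hφ : IsTest Ω φ) :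
    IsH10 Ω φ (grad φ) where
  memLp := (hφ.smooth.continuous.memLp_of_hasCompactSupport hφ.compact).restrict _
  memLp_grad := ((continuous_grad hφ.smooth).memLp_of_hasCompactSupport
    (hasCompactSupport_grad hφ.compact)).restrict _
  approx := ⟨fun _ => φ, fun _ => hφ, by simp, by simp⟩

section h10

variable {d : ℕ}

/-- `H¹₀(Ω)ᵈ` as a closed subspace of `L²(Ω; Jet d)`: the closure of the pairs `(φ, ∇φ)`
of test fields. -/
def h10 (Ω : Set (Vec d)) : Submodule ℝ (Lp (Jet d) 2 (volume.restrict Ω)) :=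
  (Submodule.span ℝ {y : Lp (Jet d) 2 (volume.restrict Ω) |
    ∃ φ, IsTest Ω φ ∧ y =ᵐ[volume.restrict Ω] jet φ (grad φ)}).topologicalClosure

/-- The projection `(v, Dv) ↦ v` from `L²(Ω; Jet d)` to `L²(Ω)ᵈ`. -/
def fieldL (Ω : Set (Vec d)) :
    Lp (Jet d) 2 (volume.restrict Ω) →L[ℝ] Lp (Vec d) 2 (volume.restrict Ω) :=
  (WithLp.fstL 2 ℝ (Vec d) (Tensor d d)).compLpL 2 _

theorem fieldL_ae_eq {Ω : Set (Vec d)} {y : Lp (Jet d) 2 (volume.restrict Ω)} {v : Vec d → Vec d}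
    {Dv : Vec d → Tensor d d} (hy : y =ᵐ[volume.restrict Ω] jet v Dv) :
    fieldL Ω y =ᵐ[volume.restrict Ω] v := by
  filter_upwards [(WithLp.fstL 2 ℝ (Vec d) (Tensor d d)).coeFn_compLpL y, hy] with x h1 h2
  rw [fieldL, h1, h2]
  rfl

theorem IsH10.mem_h10 {Ω : Set (Vec d)} {v : Vec d → Vec d} {Dv : Vec d → Tensor d d}
    (hv : IsH10 Ω v Dv) {y : Lp (Jet d) 2 (volume.restrict Ω)}
    (hy : y =ᵐ[volume.restrict Ω] jet v Dv) : y ∈ h10 Ω := by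
  obtain ⟨φ, hφ, h1, h2⟩ := hv.approx
  have hm : ∀ n, MemLp (jet (φ n) (grad (φ n))) 2 (volume.restrict Ω) := fun n =>
    memLp_jet (hφ n).isH10.memLp (hφ n).isH10.memLp_grad
  have hlim : Tendsto (fun n => (hm n).toLp _) atTop (𝓝 y) := by
    rw [tendsto_iff_edist_tendsto_0]
    have h3 := h1.add h2
    rw [add_zero] at h3
    refine tendsto_of_tendsto_of_tendsto_of_le_of_le tendsto_const_nhds h3 (fun _ => zero_le)
      fun n => ?_
    refine le_trans (le_of_eq ?_) (eLpNorm_jet_le ((hφ n).isH10.memLp.sub hv.memLp).1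
      ((hφ n).isH10.memLp_grad.sub hv.memLp_grad).1)
    rw [Lp.edist_def]
    refine eLpNorm_congr_ae ?_
    filter_upwards [(hm n).coeFn_toLp, hy] with x h4 h5
    rw [Pi.sub_apply, h4, h5]
    rfl
  refine mem_closure_of_tendsto hlim (Eventually.of_forall fun n => Submodule.subset_span ?_)
  exact ⟨φ n, hφ n, (hm n).coeFn_toLp⟩

/-- The fields of `H¹₀(Ω)ᵈ` are dense in `L²(Ω)ᵈ`. -/
theorem eq_zero_of_inner_fieldL_h10 {Ω : Set (Vec d)} (hΩ : IsOpen Ω) (hΩb : Bornology.IsBounded Ω)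
    (y : Lp (Vec d) 2 (volume.restrict Ω)) (hy : ∀ v ∈ h10 Ω, ⟪y, fieldL Ω v⟫_ℝ = 0) : y = 0 := by
  have := isFiniteMeasure_restrict_of_isBounded hΩb
  have hyi : Integrable y (volume.restrict Ω) := (Lp.memLp y).integrable (by norm_num)
  have h0 : ∀ᵐ x, x ∈ Ω → y x = 0 := by
    refine hΩ.ae_eq_zero_of_integral_contDiff_smul_eq_zero
      (IntegrableOn.locallyIntegrableOn hyi) fun g hg hgc hgs => ?_
    have hset : ∫ x, g x • y x = ∫ x in Ω, g x • y x := by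
      refine (setIntegral_eq_integral_of_forall_compl_eq_zero fun x hx => ?_).symm
      rw [image_eq_zero_of_notMem_tsupport fun h => hx (hgs h), zero_smul]
    have hgi : Integrable (fun x => g x • y x) (volume.restrict Ω) := by
      obtain ⟨C, hC⟩ := hgc.exists_bound_of_continuous hg.continuous
      exact hyi.bdd_smul C hg.continuous.aestronglyMeasurable (ae_of_all _ hC)
    rw [hset]
    -- test with the field `g e`, where `e` is the integral to be shown to vanish
    obtain ⟨e, he⟩ : ∃ e, e = ∫ x in Ω, g x • y x := ⟨_, rfl⟩
    rw [← he]
    have ht : IsTest Ω (fun x => g x • e) :=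
      ⟨hg.smul contDiff_const, hgc.smul_right,
        (closure_mono (Function.support_smul_subset_left _ _)).trans hgs⟩
    have hm := memLp_jet ht.isH10.memLp ht.isH10.memLp_grad
    have h1 := hy _ (ht.isH10.mem_h10 hm.coeFn_toLp)
    rw [inner_eq_integral_of_ae (ae_eq_refl _) (fieldL_ae_eq hm.coeFn_toLp)] at h1
    have h2 : ⟪e, e⟫_ℝ = 0 := by
      calc ⟪e, e⟫_ℝ = ⟪e, ∫ x in Ω, g x • y x⟫_ℝ := by rw [← he]
        _ = ∫ x in Ω, ⟪y x, g x • e⟫_ℝ := ?_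
        _ = 0 := h1
      rw [← integral_inner hgi]
      refine integral_congr_ae (ae_of_all _ fun x => ?_)
      simp only [inner_smul_right, real_inner_comm]
    exact inner_self_eq_zero.1 h2
  rw [Lp.eq_zero_iff_ae_eq_zero]
  exact (ae_restrict_iff' hΩ.measurableSet).2 h0

end h10

/-! ### The kinetic energy of the fluid -/

theorem memLp_jet_slab {d : ℕ} {T : ℝ} {Ω : Set (Vec d)} {v : ℝ → Vec d → Vec d}
    {Dv : ℝ → Vec d → Tensor d d} (hv : MemLp (Function.uncurry v) 2 (slab T Ω))
    (hDv : MemLp (Function.uncurry Dv) 2 (slab T Ω)) :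
    MemLp (Function.uncurry fun t => jet (v t) (Dv t)) 2 (slab T Ω) :=
  memLp_jet hv hDv

theorem ae_memLp_two_of_slab {n : ℕ} {E : Type*} [NormedAddCommGroup E] [SecondCountableTopology E]
    {T : ℝ} {U : Set (Vec n)} {f : ℝ → Vec n → E} (hf : MemLp (Function.uncurry f) 2 (slab T U)) :
    ∀ᵐ t ∂(volume.restrict (Ioo 0 T)), MemLp (f t) 2 (volume.restrict U) := by
  obtain ⟨F, -, hF⟩ := exists_memLp_two_curry hf
  filter_upwards [hF] with t ht
  exact (memLp_congr_ae ht).1 (Lp.memLp (F t))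

/-- The kinetic energy of the fluid: `‖u(t)‖²` is absolutely continuous, and its derivative at `t`
is twice the derivative of `τ ↦ (u(τ), u(t))` at `τ = t`. -/
theorem kineticEnergy {d : ℕ} {T : ℝ} (hT : 0 < T) {Ω : Set (Vec d)} (hΩ : IsOpen Ω)
    (hΩb : Bornology.IsBounded Ω) {u : ℝ → Vec d → Vec d} {gradU : ℝ → Vec d → Tensor d d}
    (hu : ∀ t ∈ Ico 0 T, MemLp (u t) 2 (volume.restrict Ω))
    (hus : MemLp (Function.uncurry u) 2 (slab T Ω))
    (hDus : MemLp (Function.uncurry gradU) 2 (slab T Ω))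
    (hu10 : ∀ᵐ t ∂(volume.restrict (Ioo 0 T)), IsH10 Ω (u t) (gradU t))
    (hut : HasTimeDerivHm1 T Ω u) {u₀ : Vec d → Vec d} {Du₀ : Vec d → Tensor d d}
    (hu₀ : IsH10 Ω u₀ Du₀) (hu0 : u 0 =ᵐ[volume.restrict Ω] u₀) :
    (∀ b ∈ Ioo 0 T, AbsolutelyContinuousOnInterval (fun t => l2Sq Ω (u t)) 0 b) ∧
    ∀ᵐ t ∂(volume.restrict (Ioo 0 T)), ∃ D,
      HasDerivAt (fun τ => ∫ x in Ω, ⟪u τ x, u t x⟫_ℝ) D t ∧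
      HasDerivAt (fun τ => l2Sq Ω (u τ)) (2 * D) t := by
  classical
  obtain ⟨g, G, hg, hG, hgG⟩ := hut
  obtain ⟨w, hw, hwg⟩ := exists_memLp_two_curry (memLp_jet_slab hg hG)
  obtain ⟨z, hz, hzu⟩ := exists_memLp_two_curry (memLp_jet_slab hus hDus)
  let uH : ℝ → Lp (Vec d) 2 (volume.restrict Ω) := fun t =>
    if h : t ∈ Ico 0 T then (hu t h).toLp (u t) else 0
  have huH : ∀ t ∈ Ico 0 T, uH t =ᵐ[volume.restrict Ω] u t := fun t h => by
    simp only [uH, dif_pos h]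
    exact (hu t h).coeFn_toLp
  have h0 : (0 : ℝ) ∈ Ico 0 T := ⟨le_rfl, hT⟩
  -- `w` represents `∂u/∂t`, and `z` the pair `(u, ∇u)`, as curves in `L²(Ω; Jet d)`
  have hwi : IntervalIntegrable w volume 0 T := by
    rw [intervalIntegrable_iff_integrableOn_Ioo_of_le hT.le]
    exact hw.integrable (by norm_num)
  have hwt : ∀ t ∈ Ico 0 T, IntervalIntegrable w volume 0 t := fun t ht => by
    refine hwi.mono_set ?_
    rw [uIcc_of_le hT.le, uIcc_of_le ht.1]
    exact Icc_subset_Icc_right ht.2.le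
  have hinner : ∀ t ∈ Ico 0 T, ∀ v, ⟪∫ ρ in 0..t, w ρ, v⟫_ℝ = ∫ ρ in 0..t, ⟪w ρ, v⟫_ℝ :=
    fun t ht v => by
      have := (innerSL ℝ v).intervalIntegral_comp_comm (hwt t ht)
      simp only [innerSL_apply_apply] at this
      rw [real_inner_comm, ← this]
      simp_rw [real_inner_comm]
  -- the weak time derivative, tested with all of the closed space `h10 Ω`
  have heq : ∀ v ∈ h10 Ω, ∀ t ∈ Ico 0 T,
      ⟪uH t, fieldL Ω v⟫_ℝ = ⟪uH 0, fieldL Ω v⟫_ℝ + ∫ ρ in 0..t, ⟪w ρ, v⟫_ℝ := by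
    intro v hv t ht
    -- the equation at time `t` says that `q` is orthogonal to `v`, a closed condition on `v`
    let q : Lp (Jet d) 2 (volume.restrict Ω) :=
      (fieldL Ω).adjoint (uH t - uH 0) - ∫ ρ in 0..t, w ρ
    have hq : ∀ y, ⟪q, y⟫_ℝ = ⟪uH t, fieldL Ω y⟫_ℝ - ⟪uH 0, fieldL Ω y⟫_ℝ -
        ∫ ρ in 0..t, ⟪w ρ, y⟫_ℝ := fun y => by
      simp only [q]
      rw [inner_sub_left, ContinuousLinearMap.adjoint_inner_left, inner_sub_left, hinner t ht]
    have hle : h10 Ω ≤ (ℝ ∙ q)ᗮ := by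
      refine Submodule.topologicalClosure_minimal _ (Submodule.span_le.2 ?_)
        (Submodule.isClosed_orthogonal _)
      rintro y ⟨φ, hφ, hy⟩
      rw [SetLike.mem_coe, Submodule.mem_orthogonal_singleton_iff_inner_right, hq,
        inner_eq_integral_of_ae (huH t ht) (fieldL_ae_eq hy),
        inner_eq_integral_of_ae (huH 0 h0) (fieldL_ae_eq hy), hgG φ _ hφ.isH10 t ht, sub_sub,
        sub_eq_zero]
      congr 1
      refine intervalIntegral.integral_congr_ae ?_
      have hall : ∀ᵐ r ∂(volume.restrict (Ioo 0 T)),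
          (∫ x in Ω, ⟪g r x, φ x⟫_ℝ) + ∫ x in Ω, ⟪G r x, grad φ x⟫_ℝ = ⟪w r, y⟫_ℝ := by
        filter_upwards [hwg, ae_memLp_two_of_slab hg, ae_memLp_two_of_slab hG] with r h1 h2 h3
        rw [inner_eq_integral_of_ae h1 hy, ← integral_add
          (integrable_inner_of_memLp_two h2 hφ.isH10.memLp)
          (integrable_inner_of_memLp_two h3 hφ.isH10.memLp_grad)]
        rfl
      rw [ae_restrict_iff' measurableSet_Ioo] at hall
      filter_upwards [hall] with r hr hrm
      exact hr (uIoc_subset_Ioo_of_mem_Ico h0 ht hrm)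
    have := Submodule.mem_orthogonal_singleton_iff_inner_right.1 (hle hv)
    rw [hq] at this
    linarith
  have hzV : ∀ᵐ t ∂(volume.restrict (Ioo 0 T)), z t ∈ h10 Ω := by
    filter_upwards [hzu, hu10] with t h1 h2 using h2.mem_h10 h1
  have hzH : ∀ᵐ t ∂(volume.restrict (Ioo 0 T)), fieldL Ω (z t) = uH t := by
    filter_upwards [hzu, ae_restrict_mem measurableSet_Ioo] with t h1 h2
    exact Lp.ext ((fieldL_ae_eq h1).trans (huH t (Ioo_subset_Ico_self h2)).symm)
  have hm0 := memLp_jet hu₀.memLp hu₀.memLp_grad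
  have henergy : ∀ t ∈ Ico 0 T, ‖uH t‖ ^ 2 = ‖uH 0‖ ^ 2 + 2 * ∫ r in 0..t, ⟪w r, z r⟫_ℝ :=
    fun t ht => norm_sq_eq_of_weak_deriv (fieldL Ω) (Submodule.isClosed_topologicalClosure _)
      (eq_zero_of_inner_fieldL_h10 hΩ hΩb) hz hw hzV hzH (hu₀.mem_h10 hm0.coeFn_toLp)
      (Lp.ext ((fieldL_ae_eq hm0.coeFn_toLp).trans (hu0.symm.trans (huH 0 h0).symm))) heq ht
  have hnorm : ∀ t ∈ Ico 0 T, ‖uH t‖ ^ 2 = l2Sq Ω (u t) := fun t ht => by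
    rw [← real_inner_self_eq_norm_sq, inner_eq_integral_of_ae (huH t ht) (huH t ht), l2Sq]
    simp_rw [real_inner_self_eq_norm_sq]
  have hac := absolutelyContinuous_of_eq_integral (φ := fun t => l2Sq Ω (u t))
    (e := fun r => 2 * ⟪w r, z r⟫_ℝ) h0 ((integrable_inner_of_memLp_two hw hz).const_mul 2)
    (fun t ht => by
      rw [← hnorm t ht, ← hnorm 0 h0, henergy t ht, intervalIntegral.integral_const_mul])
  refine ⟨hac.1, ?_⟩
  have hdw := hwi.ae_hasDerivAt_integral
  rw [← ae_restrict_iff' measurableSet_uIcc, uIcc_of_le hT.le] at hdw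
  have hdw' := ae_restrict_of_ae_restrict_of_subset Ioo_subset_Icc_self hdw
  filter_upwards [hac.2, hdw', hzV, hzH, ae_restrict_mem measurableSet_Ioo] with t h1 h2 h3 h4 htm
  -- at a Lebesgue point of the vector valued `w` all products `(u(τ), v)` are differentiable, so
  -- that `v` may depend on `t`
  refine ⟨⟪w t, z t⟫_ℝ, ?_, h1⟩
  have h5 := (h2 0 ⟨le_rfl, hT.le⟩).inner ℝ (hasDerivAt_const t (z t))
  rw [inner_zero_right, zero_add] at h5
  refine (h5.const_add ⟪uH 0, fieldL Ω (z t)⟫_ℝ).congr_of_eventuallyEq ?_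
  filter_upwards [Ioo_mem_nhds htm.1 htm.2] with τ hτ
  have hτ' := Ioo_subset_Ico_self hτ
  rw [hinner τ hτ', ← heq _ h3 τ hτ', h4,
    inner_eq_integral_of_ae (huH τ hτ') (huH t (Ioo_subset_Ico_self htm))]

/-! ### The energy identity -/

theorem gradient_norm_sq {E : Type*} [NormedAddCommGroup E] [InnerProductSpace ℝ E]
    [CompleteSpace E] (x : E) : gradient (fun y : E => ‖y‖ ^ 2) x = (2 : ℝ) • x := by
  refine ext_inner_right ℝ fun y => ?_
  rw [gradient, InnerProductSpace.toDual_symm_apply, fderiv_norm_sq_apply, inner_smul_left]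
  simp

theorem memLp_symGrad {d : ℕ} {α : Type*} [MeasurableSpace α] {μ : Measure α}
    {A : α → Tensor d d} (hA : MemLp A 2 μ) : MemLp (fun x => symGrad (A x)) 2 μ := by
  let L : Tensor d d →ₗ[ℝ] Tensor d d :=
    { toFun := symGrad
      map_add' := fun A B => by ext ij; simp [symGrad]; ring
      map_smul' := fun c A => by ext ij; simp [symGrad]; ring }
  exact (LinearMap.toContinuousLinearMap L).comp_memLp' hA

theorem IsH1.congr {d m : ℕ} {U : Set (Vec m)} {Y Y' : Vec m → Vec d} {G : Vec m → Tensor d m}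
    (h : IsH1 U Y G) (hY : Y =ᵐ[volume.restrict U] Y') : IsH1 U Y' G where
  memLp := (memLp_congr_ae hY).1 h.memLp
  memLp_grad := h.memLp_grad
  weakGrad φ hφ i j := by
    rw [← h.weakGrad φ hφ i j]
    refine integral_congr_ae ?_
    filter_upwards [hY] with s hs
    rw [hs]

/-- Tested with the velocity itself, the fluid form reduces to the rate of kinetic energy and the
dissipation: the convective terms cancel, and the pressure term vanishes by incompressibility. -/
theorem fluidForm_self {d m : ℕ} {Ω : Set (Vec d)} {ρf ν : ℝ} {f : Fields d m} {t D : ℝ}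
    (hp : ∫ x in Ω, divG (f.gradU t x) * f.p t x = 0) :
    fluidForm Ω ρf ν f t (f.u t) (f.gradU t) D =
      ρf * D + ν * l2Sq Ω (fun x => symGrad (f.gradU t x)) := by
  simp only [fluidForm, hp, sub_self, zero_div, add_zero, sub_zero, l2Sq,
    real_inner_self_eq_norm_sq]

/-- The energy identity follows from the momentum equation tested with the velocity `u(t)` of the
fluid, whose value on the solid is `∂X/∂t`. -/
theorem IsAdmissible.energyIdentity {d m : ℕ} {T : ℝ} (hT : 0 < T) {Ω : Set (Vec d)}
    (hΩ : IsOpen Ω) (hΩb : Bornology.IsBounded Ω) {B : Set (Vec m)} (hBb : Bornology.IsBounded B)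
    {ρf ν δρ : ℝ} {W : Tensor d m → ℝ} (hW : ContDiff ℝ 1 W) (hWconv : ConvexOn ℝ univ W)
    (hWpos : ∀ F, 0 ≤ W F) {f : Fields d m} (h : IsAdmissible T Ω B W f)
    {u₀ : Vec d → Vec d} (hu₀ : ∃ Du₀, IsH10 Ω u₀ Du₀) (hu0 : f.u 0 =ᵐ[volume.restrict Ω] u₀)
    (hmom : ∀ᵐ t ∂(volume.restrict (Ioo 0 T)), ∃ D,
      HasDerivAt (fun τ => ∫ x in Ω, ⟪f.u τ x, f.u t x⟫_ℝ) D t ∧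
      fluidForm Ω ρf ν f t (f.u t) (f.gradU t) D + δρ * (∫ s in B, ⟪f.Xtt t s, f.Xt t s⟫_ℝ)
        + ∫ s in B, ⟪stress W (f.F t s), f.gradXt t s⟫_ℝ = 0) :
    EnergyIdentity T Ω B ρf ν δρ W f := by
  obtain ⟨Du₀, hDu₀⟩ := hu₀
  obtain ⟨hK1, hK2⟩ := kineticEnergy hT hΩ hΩb h.u_memLp h.u_slab h.gradU_slab h.u_H10 h.u_time
    hDu₀ hu0
  obtain ⟨hE1, hE2, hE3⟩ := h.F_time.energy hT hBb hW hWconv hWpos h.stress_slab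
  have hsq : MemLp (Function.uncurry fun t s => gradient (fun y : Vec d => ‖y‖ ^ 2) (f.Xt t s)) 2
      (slab T B) := by
    simp_rw [gradient_norm_sq]
    exact h.Xt_time.memLp.const_smul (2 : ℝ)
  obtain ⟨hS1, hS2, hS3⟩ := h.Xt_time.energy hT hBb (W := fun y => ‖y‖ ^ 2) (contDiff_norm_sq ℝ)
    (convexOn_univ_norm.pow (fun _ _ => norm_nonneg _) 2) (fun _ => sq_nonneg _) hsq
  refine ⟨fun t ht => ⟨h.u_memLp t ht,
    (memLp_two_iff_integrable_sq_norm (hS1 t ht).1).2 (hS1 t ht).2, (hE1 t ht).2⟩,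
    fun b hb => ⟨hK1 b hb, hS2 b hb, hE2 b hb⟩, ?_⟩
  filter_upwards [hK2, hS3, hE3, h.u_H10, h.p_L20, h.div_free, hmom]
    with t ⟨D, hD, hk⟩ hs he h10 hp hdiv ⟨D', hD', hmom⟩
  obtain rfl := hD.unique hD'
  refine ⟨memLp_symGrad h10.memLp_grad, _, _, _, hk, hs, he, ?_⟩
  rw [fluidForm_self (hdiv _ hp)] at hmom
  have hXt : ∫ s in B, ⟪gradient (fun y : Vec d => ‖y‖ ^ 2) (f.Xt t s), f.Xtt t s⟫_ℝ =
      2 * ∫ s in B, ⟪f.Xtt t s, f.Xt t s⟫_ℝ := by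
    rw [← integral_const_mul]
    refine integral_congr_ae (ae_of_all _ fun s => ?_)
    simp only [gradient_norm_sq, inner_smul_left, real_inner_comm]
    simp
  rw [hXt]
  change _ + ∫ s in B, ⟪stress W (f.F t s), f.gradXt t s⟫_ℝ = 0
  linarith

theorem IsIBMSolution.energyIdentity {d m : ℕ} {T : ℝ} (hT : 0 < T) {Ω : Set (Vec d)}
    (hΩ : IsOpen Ω) (hΩb : Bornology.IsBounded Ω) {B : Set (Vec m)} (hBb : Bornology.IsBounded B)
    {ρf ν δρ : ℝ} {W : Tensor d m → ℝ} (hW : ContDiff ℝ 1 W) (hWconv : ConvexOn ℝ univ W)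
    (hWpos : ∀ F, 0 ≤ W F) {f : Fields d m} {u₀ : Vec d → Vec d} {X₀ : Vec m → Vec d}
    (h : IsIBMSolution T Ω B ρf ν δρ W u₀ X₀ f) : EnergyIdentity T Ω B ρf ν δρ W f := by
  refine h.admissible.energyIdentity hT hΩ hΩb hBb hW hWconv hWpos h.u₀_H10 h.initial_u ?_
  filter_upwards [h.momentum, h.motion, h.admissible.u_H10, h.admissible.Xt_H1] with t h1 h2 h3 h4
  obtain ⟨D, hD, e⟩ := h1 _ _ _ _ h3 h4 h2
  exact ⟨D, hD, by linarith⟩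

/-- The multiplier drops out: the coupling condition for `u(t)` and `∂X/∂t`, tested with the
multiplier itself, equates its two occurrences in the fluid and in the solid equation. -/
theorem IsDLMSolution.energyIdentity {d m : ℕ} {T : ℝ} (hT : 0 < T) {Ω : Set (Vec d)}
    (hΩ : IsOpen Ω) (hΩb : Bornology.IsBounded Ω) {B : Set (Vec m)} (hBb : Bornology.IsBounded B)
    {ρf ν δρ : ℝ} {W : Tensor d m → ℝ} (hW : ContDiff ℝ 1 W) (hWconv : ConvexOn ℝ univ W)
    (hWpos : ∀ F, 0 ≤ W F) {f : Fields d m} {u₀ : Vec d → Vec d} {X₀ : Vec m → Vec d}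
    {Λ : Type*} [AddCommGroup Λ] [Module ℝ Λ]
    {H₁ H₂ : Submodule ℝ (Lp (Vec d) 2 (volume.restrict B))}
    {c₁ : Λ →ₗ[ℝ] H₁ →ₗ[ℝ] ℝ} {c₂ : Λ →ₗ[ℝ] H₂ →ₗ[ℝ] ℝ} {mult : ℝ → Λ}
    (h : IsDLMSolution T Ω B ρf ν δρ W u₀ X₀ f H₁ H₂ c₁ c₂ mult) :
    EnergyIdentity T Ω B ρf ν δρ W f := by
  refine h.admissible.energyIdentity hT hΩ hΩb hBb hW hWconv hWpos h.u₀_H10 h.initial_u ?_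
  filter_upwards [h.fluid, h.solid, h.motion, h.admissible.u_H10, h.admissible.Xt_H1]
    with t h1 h2 hm h3 h4
  obtain ⟨z, y, hz, hy, hzy⟩ := hm
  obtain ⟨D, hD, e⟩ := h1 _ _ z h3 hz
  have e2 := h2 y _ (h4.congr hy.symm)
  have e4 : ∫ s in B, ⟪f.Xtt t s, y.1 s⟫_ℝ = ∫ s in B, ⟪f.Xtt t s, f.Xt t s⟫_ℝ := by
    refine integral_congr_ae ?_
    filter_upwards [hy] with s hs
    rw [hs]
  rw [e4] at e2
  have e3 := hzy (mult t)
  generalize c₁ (mult t) z = a at e e3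
  generalize c₂ (mult t) y = b at e2 e3
  exact ⟨D, hD, by linarith⟩

end FSI
end

theorem mainTheorem3 {d m : ℕ} (hd : d = 2 ∨ d = 3) (hm : m = d ∨ m + 1 = d)
    (Ω : Set (FSI.Vec d)) (hΩ : IsOpen Ω) (hΩb : Bornology.IsBounded Ω)
    (B : Set (FSI.Vec m)) (hB : IsOpen B) (hBb : Bornology.IsBounded B)
    (T ρf ρs ν ts : ℝ) (hT : 0 < T) (hρf : 0 < ρf) (hρs : 0 < ρs) (hν : 0 < ν) (hts : 0 < ts)
    (W : FSI.Tensor d m → ℝ) (hW : ContDiff ℝ 1 W) (hWconv : ConvexOn ℝ Set.univ W)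
    (hWpos : ∀ F, 0 ≤ W F)
    (u₀ : FSI.Vec d → FSI.Vec d) (X₀ : FSI.Vec m → FSI.Vec d) (f : FSI.Fields d m) :
    (FSI.IsIBMSolution T Ω B ρf ν (FSI.deltaRho d m ρf ρs ts) W u₀ X₀ f →
      FSI.EnergyIdentity T Ω B ρf ν (FSI.deltaRho d m ρf ρs ts) W f) ∧
    (∀ {Λ : Type*} [AddCommGroup Λ] [Module ℝ Λ]
      (H₁ H₂ : Submodule ℝ
        (MeasureTheory.Lp (FSI.Vec d) 2 (MeasureTheory.volume.restrict B)))
      (c₁ : Λ →ₗ[ℝ] H₁ →ₗ[ℝ] ℝ) (c₂ : Λ →ₗ[ℝ] H₂ →ₗ[ℝ] ℝ) (mult : ℝ → Λ),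
      FSI.IsDLMSolution T Ω B ρf ν (FSI.deltaRho d m ρf ρs ts) W u₀ X₀ f H₁ H₂ c₁ c₂ mult →
        FSI.EnergyIdentity T Ω B ρf ν (FSI.deltaRho d m ρf ρs ts) W f) :=
  ⟨fun h => h.energyIdentity hT hΩ hΩb hBb hW hWconv hWpos,
    fun _ _ _ _ _ h => h.energyIdentity hT hΩ hΩb hBb hW hWconv hWpos⟩
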